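/- **Theorem.** Let $\mathbb F$ be an algebraically closed field of characteristic $0$, let $\mathfrak g$ be a finite-dimensional simple Lie algebra over $\mathbb F$ with a non-degenerate symmetric invariant bilinear form $(\cdot\,|\,\cdot)$, and let $\{f,2x,e\}\subset\mathfrak g$ be an $\mathfrak{sl}_2$-triple ($[e,f]=2x\neq0$, $[x,e]=e$, $[x,f]=-f$). Denote by $\mathfrak g_j$ the eigenspace of $\operatorname{ad}x$ with eigenvalue $j\in\frac12\mathbb Z$, put $\mathfrak g_{\le k}=\bigoplus_{j\le k}\mathfrak g_j$, $\mathfrak g_{\ge k}=\bigoplus_{j\ge k}\mathfrak g_j$, and assume that $f$ is *short*, i.e. $\mathfrak g=\mathfrak g_{-1}\oplus\mathfrak g_0\oplus\mathfrak g_1$. Let $s\in\mathfrak g_1$ and $z\in\mathbb F$. *The $\mathcal W$-algebra.* For a subspace $\mathfrak a\subset\mathfrak g$ let $\mathcal V(\mathfrak a)=S(\mathbb F[\partial]\mathfrak a)$ be the algebra of differential polynomials over $\mathfrak a$, with derivation $\partial$. For a basis $\{u_i\}$ of $\mathfrak g$, define a $\lambda$-bracket $\{\cdot\,_\lambda\,\cdot\}_z:\mathcal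 V(\mathfrak g)\otimes\mathcal V(\mathfrak g)\to\mathcal V(\mathfrak g)[\lambda]$ by $\{a_\lambda b\}_z=[a,b]+(a|b)\lambda+z(s|[a,b])$ for $a,b\in\mathfrak g$ and $$\{p_\lambda q\}_z=\sum_{i,j,m,n}\frac{\partial q}{\partial u_j^{(n)}}(\lambda+\partial)^n\{u_i\,{}_{\lambda+\partial}\,u_j\}_{z\,\to}(-\lambda-\partial)^m\frac{\partial p}{\partial u_i^{(m)}}$$ in general, where $u_i^{(n)}=\partial^nu_i$ and the arrow means that the powers of $\lambda+\partial$ act on what follows to the right. Let $\rho:\mathcal V(\mathfrak g)\to\mathcal V(\mathfrak g_{\le\frac12})$ be the differential algebra homomorphism with $\rho(a)=\pi_{\le\frac12}(a)+(f|a)$ for $a\in\mathfrak g$, where $\pi_{\le\frac12}:\mathfrak g\to\mathfrak g_{\le\frac12}$ is the projection with kernel $\mathfrak g_{\ge1}$; apply $\rho$ to polynomials in $\lambda$ coefficientwise. Set $$\mathcal W=\big\{p\in\mathcal V(\mathfrak g_{\le\frac12})\ \big|\ \rho\{a_\lambda p\}_z=0\text{ for all }a\in\mathfrak g_{\ge\frac12}\big\}.$$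 Let $\mathcal V(\mathfrak g_{\le\frac12})\{\Delta\}$ be the span of the products $a_1^{(m_1)}\cdots a_r^{(m_r)}$ with $a_i\in\mathfrak g_{1-\Delta_i}$, $\Delta_i\ge\frac12$, and $\sum_i(\Delta_i+m_i)=\Delta$ (conformal weight $\Delta$), and put $\mathcal W\{\Delta\}=\mathcal W\cap\mathcal V(\mathfrak g_{\le\frac12})\{\Delta\}$. *The map $\psi$.* Let $\mathfrak g_0^f$ be the centralizer of $f$ in $\mathfrak g_0$ and $\{a_i\}_{i\in I}$ a basis of it. Let $\{u_k\}_{k\in K}$ be a basis of $\mathfrak g_{-1}$ and $\{u^k\}_{k\in K}$ the basis of $\mathfrak g_1$ with $(u_k|u^l)=\delta_{kl}$. With the Jordan product $v\circ w=[[e,v],w]$ on $\mathfrak g_{-1}$, define for $v\in\mathfrak g_{-1}$ $$\psi(v)=v-\frac12\sum_{k\in K}[v,u^k][e,u_k]-\frac18\sum_{k\in K}[f,u^k][e,v\circ u_k]+\frac12\partial[e,v].$$ Then: 1. $\mathcal W$ is the algebra of differential polynomials in the generators $a_i$ ($i\in I$) and $\psi(u_k)$ ($k\in K$): the elements $\partial^na_i$,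 $\partial^n\psi(u_k)$ ($n\ge0$) are algebraically independent over $\mathbb F$, and the subalgebra of $\mathcal V(\mathfrak g_{\le\frac12})$ that they generate is $\mathcal W$. 2. $\psi$ is an injective map from $\mathfrak g_{-1}$ to $\mathcal W\{2\}$. 3. $\mathcal W\{1\}=\mathfrak g_0^f$ and $\mathcal W\{2\}=\psi(\mathfrak g_{-1})\oplus\partial\mathfrak g_0^f\oplus S^2\mathfrak g_0^f$, where $S^2\mathfrak g_0^f$ is the span of the products of two elements of $\mathfrak g_0^f$ in $\mathcal V(\mathfrak g)$. -/

import Mathlib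

open Polynomial

noncomputable section

namespace ClassicalW

/-! ### Algebras of differential polynomials and lambda-brackets -/

/-- The algebra of differential polynomials `F[u_i^{(n)} | i ∈ ι, n ≥ 0]`; the variable
`u_i^{(n)}` is `X (i, n)`. -/
abbrev DiffPoly (F : Type*) [Field F] (ι : Type*) := MvPolynomial (ι × ℕ) F

section DiffPoly

variable {F : Type*} [Field F] {ι : Type*}

/-- The derivation `∂` with `∂ u_i^{(n)} = u_i^{(n+1)}`. -/
def del : Derivation F (DiffPoly F ι) (DiffPoly F ι) :=
  MvPolynomial.mkDerivation F fun p => MvPolynomial.X (p.1, p.2 + 1)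

/-- The operator `λ + ∂` on `V[λ]`, where `∂` acts on the coefficients. -/
def lamDel (P : (DiffPoly F ι)[X]) : (DiffPoly F ι)[X] :=
  X * P + P.sum fun k c => monomial k (del c)

/-- For `H = ∑ c_k λ^k`, the operator `H(λ + ∂) = ∑ c_k (λ + ∂)^k` applied to `P ∈ V[λ]`
(the powers of `∂` act on `P`). -/
def applyLamDel (H P : (DiffPoly F ι)[X]) : (DiffPoly F ι)[X] :=
  H.sum fun k c => C c * lamDel^[k] P

/-- The lambda-bracket `{p _λ q}` on differential polynomials with prescribed values
`H i j = {u_i _λ u_j}` on the generators, given by the Master Formula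
`∑ ∂q/∂u_j^{(n)} (λ+∂)^n {u_i _{λ+∂} u_j} (-λ-∂)^m ∂p/∂u_i^{(m)}`
(only the variables that occur in `p`, `q` contribute). -/
def lambdaBracket (H : ι → ι → (DiffPoly F ι)[X]) (p q : DiffPoly F ι) : (DiffPoly F ι)[X] :=
  ∑ jn ∈ q.vars, ∑ im ∈ p.vars,
    C (MvPolynomial.pderiv jn q) *
      lamDel^[jn.2] (applyLamDel (H im.1 jn.1)
        ((fun P => -lamDel P)^[im.2] (C (MvPolynomial.pderiv im p))))

/-- `W` is the algebra of differential polynomials in the elements `w_j`, `j ∈ J`: it is the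
subalgebra generated by all derivatives `∂^n w_j`, and these are algebraically independent. -/
def IsDiffPolyAlgebraOn {J : Type*} (W : Set (DiffPoly F ι)) (w : J → DiffPoly F ι) : Prop :=
  W = (Algebra.adjoin F (Set.range fun p : J × ℕ => del^[p.2] (w p.1)) :
    Set (DiffPoly F ι)) ∧
  AlgebraicIndependent F fun p : J × ℕ => del^[p.2] (w p.1)

end DiffPoly

/-! ### The `ad x`-grading -/

section Grading

variable (F : Type*) [Field F] {g : Type*} [LieRing g] [LieAlgebra F g]

/-- The eigenspace `g_j` of `ad x` with eigenvalue `j`. If `2x` belongs to an `sl₂`-triple and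
`g` is finite dimensional, it vanishes unless `j` is a half-integer. -/
def gr (x : g) (j : ℚ) : Submodule F g :=
  Module.End.eigenspace (LieAlgebra.ad F g x) (j : F)

/-- `g_{≤ k}`. -/
def grLE (x : g) (k : ℚ) : Submodule F g := ⨆ j : ℚ, ⨆ _ : j ≤ k, gr F x j

/-- `g_{≥ k}`. -/
def grGE (x : g) (k : ℚ) : Submodule F g := ⨆ j : ℚ, ⨆ _ : k ≤ j, gr F x j

/-- `g_0^f`, the centralizer of `f` in `g_0`. -/
def gr0Cent (x f : g) : Submodule F g := gr F x 0 ⊓ LinearMap.ker (LieAlgebra.ad F g f : g →ₗ[F] g)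

/-- The nilpotent element `f` of an `sl₂`-triple `{f, 2x, e}` is short when
`g = g_{-1} ⊕ g_0 ⊕ g_1` (sums of distinct eigenspaces are direct). -/
def IsShort (x : g) : Prop := gr F x (-1) ⊔ gr F x 0 ⊔ gr F x 1 = ⊤

open Classical in
/-- The projection `π_{≤ 1/2} : g → g_{≤ 1/2}` with kernel `g_{≥ 1}`, as an endomorphism of `g`.
The two subspaces are complementary for every `sl₂`-triple (see `isCompl_of_isShort` for the short
case); the value `0` otherwise is never used. -/
def projLE (x : g) : g →ₗ[F] g :=
  if h : IsCompl (grLE F x (1 / 2)) (grGE F x 1) then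
    (grLE F x (1 / 2)).projection (grGE F x 1) h
  else 0

theorem isCompl_of_isShort [CharZero F] (x : g) (h : IsShort F x) :
    IsCompl (grLE F x (1 / 2)) (grGE F x 1) := by
  have hind : iSupIndep (gr F x) :=
    (Module.End.eigenspaces_iSupIndep (LieAlgebra.ad F g x)).comp
      (f := fun j : ℚ => (j : F)) Rat.cast_injective
  constructor
  · have hd : Disjoint {j : ℚ | j ≤ 1 / 2} {j : ℚ | 1 ≤ j} := by
      rw [Set.disjoint_left]
      intro j h1 h2
      change j ≤ 1 / 2 at h1
      change 1 ≤ j at h2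
      linarith
    exact hind.disjoint_biSup_biSup hd
  · rw [codisjoint_iff, eq_top_iff, ← h]
    refine sup_le (sup_le ?_ ?_) ?_
    · exact (le_iSup₂_of_le (-1) (by norm_num) le_rfl : gr F x (-1) ≤ grLE F x (1 / 2)).trans
        le_sup_left
    · exact (le_iSup₂_of_le 0 (by norm_num) le_rfl : gr F x 0 ≤ grLE F x (1 / 2)).trans
        le_sup_left
    · exact (le_iSup₂_of_le 1 le_rfl le_rfl : gr F x 1 ≤ grGE F x 1).trans le_sup_right

end Grading

/-! ### The classical W-algebra

`V(g) = S(F[∂] g)` is realized as the algebra of differential polynomials in the elements of a basis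
`b` of `g`. -/

section WAlgebra

variable {F : Type*} [Field F] {g : Type*} [LieRing g] [LieAlgebra F g]
  {ι : Type*} (b : Module.Basis ι F g)

/-- The embedding `g ⊂ V(g)`. -/
def emb : g →ₗ[F] DiffPoly F ι := b.constr F fun i => MvPolynomial.X (i, 0)

/-- The values `{u_i _λ u_j}_z = [u_i, u_j] + (u_i | u_j) λ + z (s | [u_i, u_j])` on the basis. -/
def affineTable (κ : LinearMap.BilinForm F g) (s : g) (z : F) (i j : ι) : (DiffPoly F ι)[X] :=
  C (emb b ⁅b i, b j⁆) + C (MvPolynomial.C (κ (b i) (b j))) * X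
    + C (MvPolynomial.C (z * κ s ⁅b i, b j⁆))

/-- The lambda-bracket `{p _λ q}_z` on `V(g)`. -/
def affineBracket (κ : LinearMap.BilinForm F g) (s : g) (z : F) (p q : DiffPoly F ι) :
    (DiffPoly F ι)[X] :=
  lambdaBracket (affineTable b κ s z) p q

/-- The differential subalgebra `V(g_{≤ 1/2})` of `V(g)`. -/
def subLE (x : g) : Subalgebra F (DiffPoly F ι) :=
  Algebra.adjoin F {p | ∃ a ∈ grLE F x (1 / 2), ∃ n : ℕ, p = del^[n] (emb b a)}

/-- The differential algebra homomorphism `ρ : V(g) → V(g_{≤ 1/2}) ⊂ V(g)` with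
`ρ(a) = π_{≤ 1/2}(a) + (f | a)` for `a ∈ g`. -/
def rho (κ : LinearMap.BilinForm F g) (x f : g) : DiffPoly F ι →ₐ[F] DiffPoly F ι :=
  MvPolynomial.aeval fun p : ι × ℕ =>
    del^[p.2] (emb b (projLE F x (b p.1)) + MvPolynomial.C (κ f (b p.1)))

/-- The classical W-algebra, as a subset of `V(g)`: the elements `p` of `V(g_{≤ 1/2})` with
`ρ {a _λ p}_z = 0` for all `a ∈ g_{≥ 1/2}` (`ρ` is applied to the coefficients). -/
def wAlgebra (κ : LinearMap.BilinForm F g) (x f s : g) (z : F) : Set (DiffPoly F ι) :=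
  {p | p ∈ subLE b x ∧ ∀ a ∈ grGE F x (1 / 2),
    (affineBracket b κ s z (emb b a) p).map (rho b κ x f : DiffPoly F ι →+* DiffPoly F ι) = 0}

/-- The space `V(g_{≤ 1/2}){Δ}` of elements of conformal weight `Δ`, spanned by the products
`a_1^{(m_1)} ⋯ a_r^{(m_r)}` with `a_i ∈ g_{1 - Δ_i}`, `Δ_i ≥ 1/2`, and
`Δ_1 + ⋯ + Δ_r + m_1 + ⋯ + m_r = Δ`. -/
def weightSpace (x : g) (Δ : ℚ) : Submodule F (DiffPoly F ι) :=
  Submodule.span F {p | ∃ (r : ℕ) (a : Fin r → g) (δ : Fin r → ℚ) (m : Fin r → ℕ),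
    (∀ i, 1 / 2 ≤ δ i ∧ a i ∈ gr F x (1 - δ i)) ∧
    ∑ i, (δ i + (m i : ℚ)) = Δ ∧ p = ∏ i, del^[m i] (emb b (a i))}

/-- `W{Δ} = W ∩ V(g_{≤ 1/2}){Δ}`. -/
def wWeight (κ : LinearMap.BilinForm F g) (x f s : g) (z : F) (Δ : ℚ) : Set (DiffPoly F ι) :=
  wAlgebra b κ x f s z ∩ weightSpace b x Δ

/-- The Jordan product `v ∘ w = [[e, v], w]` on `g_{-1}`. -/
def jordan (e v w : g) : g := ⁅⁅e, v⁆, w⁆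

/-- The linear map given by
`ψ(v) = v - 1/2 ∑ [v, u^k] [e, u_k] - 1/8 ∑ [f, u^k] [e, v ∘ u_k] + 1/2 ∂ [e, v]`,
where `u k` stands for `u_k` and `ud k` for `u^k`. It is used for `v ∈ g_{-1}`. -/
def psi {K : Type*} [Fintype K] (e f : g) (u ud : K → g) : g →ₗ[F] DiffPoly F ι where
  toFun v :=
    emb b v
      - (1 / 2 : F) • ∑ k, emb b ⁅v, ud k⁆ * emb b ⁅e, u k⁆
      - (1 / 8 : F) • ∑ k, emb b ⁅f, ud k⁆ * emb b ⁅e, jordan e v (u k)⁆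
      + (1 / 2 : F) • del (emb b ⁅e, v⁆)
  map_add' v w := by
    simp only [jordan, lie_add, add_lie, map_add, add_mul, mul_add, Finset.sum_add_distrib,
      smul_add]
    abel
  map_smul' c v := by
    simp only [jordan, lie_smul, smul_lie, map_smul, Derivation.map_smul, smul_mul_assoc,
      mul_smul_comm, ← Finset.smul_sum, RingHom.id_apply, smul_add, smul_sub, smul_comm c]

end WAlgebra

end ClassicalW

end

noncomputable section

namespace ClassicalW

/-! ### Homomorphisms of differential algebras -/

section DiffHom

variable {F : Type*} [Field F] {ι σ : Type*}

/-! For a short grading `g_{≤1/2} = g_{-1} ⊕ g_0` and `g_{≥1/2} = g_1`. Since `ρ` fixes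
`V(g_{≤1/2})`, the operator `p ↦ ρ{a_λ p}_z` with `a ∈ g_1` is a derivation there, with values in
`V[λ]`, that turns `∂` into `λ + ∂`. It is therefore determined by its values on `g_{-1}` and `g_0`.
On `g_0` it is the scalar `(f | [a, q])`: zero for `q ∈ g_0^f`, and `-2 (a | v)` for `q = [e, v]`.
The terms with `z` vanish by orthogonality.

The elements `ψ(v)` are killed as well (`redBracket_psi`): dual bases contract the two sums, the
term `½ ∂[e, v]` removes the part linear in `λ`, and what is left cancels by commutativity of the
Jordan product (`ShortTriple.jordan_identity`).

Now `g_0 = g_0^f ⊕ [e, g_{-1}]`, and `ψ(v)` is `v` plus a differential polynomial in `g_0`. By this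
triangularity the `a_i`, `ψ(u_k)` and `[e, u_k]` freely generate `V(g_{≤1/2})` as a differential
algebra (`toAdapted_diffHom`, `diffHom_toAdapted`). In these coordinates the operator of `u^k` is
`-2 ∑ λ^n ∂/∂[e, u_k]^{(n)}` (`redBracket_diffHom`), so in characteristic zero `W` consists of the
polynomials free of all `[e, u_k]^{(n)}`. This gives the structure of `W`.

In weight two an element is `v + ∂q + Q` with `Q` quadratic in `g_0`. If it lies in `W`, subtracting
`ψ(v)` and setting the variables `[e, u_k]^{(n)}` to zero leaves only terms in `∂ g_0^f` and `S²
g_0^f`. Injectivity of `ψ` and directness of the sum are read off from linear terms. -/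

lemma del_X (p : ι × ℕ) :
    del (MvPolynomial.X p : DiffPoly F ι) = MvPolynomial.X (p.1, p.2 + 1) := by
  simp [del]

lemma del_iterate_X (i : ι) (n : ℕ) :
    del^[n] (MvPolynomial.X (i, 0) : DiffPoly F ι) = MvPolynomial.X (i, n) := by
  induction n with
  | zero => rfl
  | succ n ih => rw [Function.iterate_succ_apply', ih, del_X]

lemma del_iterate_zero (n : ℕ) : del^[n] (0 : DiffPoly F ι) = 0 := by
  induction n with
  | zero => rfl
  | succ n ih => simp only [Function.iterate_succ_apply', ih, map_zero]

/-- The homomorphism of differential algebras with prescribed values on the generators. -/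
def diffHom (w : ι → DiffPoly F σ) : DiffPoly F ι →ₐ[F] DiffPoly F σ :=
  MvPolynomial.aeval fun p => del^[p.2] (w p.1)

lemma diffHom_X (w : ι → DiffPoly F σ) (p : ι × ℕ) :
    diffHom w (MvPolynomial.X p) = del^[p.2] (w p.1) := by
  simp [diffHom]

lemma diffHom_del (w : ι → DiffPoly F σ) (p : DiffPoly F ι) :
    diffHom w (del p) = del (diffHom w p) := by
  induction p using MvPolynomial.induction_on with
  | C c => simp [MvPolynomial.derivation_C, diffHom, MvPolynomial.algebraMap_eq]
  | add p q hp hq => simp only [map_add, hp, hq]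
  | mul_X p i hp =>
    simp only [Derivation.leibniz, smul_eq_mul, map_add, map_mul, hp, del_X, diffHom_X,
      Function.iterate_succ_apply']

lemma diffHom_del_iterate (w : ι → DiffPoly F σ) (n : ℕ) (p : DiffPoly F ι) :
    diffHom w (del^[n] p) = del^[n] (diffHom w p) := by
  induction n with
  | zero => rfl
  | succ n ih => simp only [Function.iterate_succ_apply', ih, diffHom_del]

/-! ### The operator `λ + ∂` -/

lemma coeff_lamDel (P : (DiffPoly F ι)[X]) (n : ℕ) :
    (lamDel P).coeff n = (X * P).coeff n + del (P.coeff n) := by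
  rw [lamDel, Polynomial.coeff_add, Polynomial.sum_def, Polynomial.finsetSum_coeff]
  congr 1
  simp only [Polynomial.coeff_monomial]
  rw [Finset.sum_ite_eq' P.support n fun k => del (P.coeff k)]
  split_ifs with h
  · rfl
  · rw [Polynomial.notMem_support_iff.mp h, map_zero]

lemma lamDel_add (P Q : (DiffPoly F ι)[X]) : lamDel (P + Q) = lamDel P + lamDel Q := by
  ext1 n
  simp only [coeff_lamDel, mul_add, Polynomial.coeff_add, map_add]
  abel

lemma lamDel_zero : lamDel (0 : (DiffPoly F ι)[X]) = 0 := by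
  ext1 n
  simp [coeff_lamDel]

lemma lamDel_C_mul (c : DiffPoly F ι) (P : (DiffPoly F ι)[X]) :
    lamDel (C c * P) = C (del c) * P + C c * lamDel P := by
  ext1 n
  rw [coeff_lamDel, show X * (C c * P) = C c * (X * P) by ring]
  simp only [Polynomial.coeff_add, Polynomial.coeff_C_mul, coeff_lamDel, Derivation.leibniz,
    smul_eq_mul]
  ring

lemma lamDel_C_C_mul (c : F) (P : (DiffPoly F ι)[X]) :
    lamDel (C (MvPolynomial.C c) * P) = C (MvPolynomial.C c) * lamDel P := by
  rw [lamDel_C_mul, MvPolynomial.derivation_C, map_zero, zero_mul, zero_add]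

lemma lamDel_iterate_add (n : ℕ) (P Q : (DiffPoly F ι)[X]) :
    lamDel^[n] (P + Q) = lamDel^[n] P + lamDel^[n] Q := by
  induction n with
  | zero => rfl
  | succ n ih => simp only [Function.iterate_succ_apply', ih, lamDel_add]

lemma lamDel_iterate_C (n : ℕ) (c : F) :
    lamDel^[n] (C (MvPolynomial.C c) : (DiffPoly F ι)[X]) = C (MvPolynomial.C c) * X ^ n := by
  induction n with
  | zero => simp
  | succ n ih =>
    rw [Function.iterate_succ_apply', ih, lamDel_C_C_mul, pow_succ']
    congr 1
    ext1 m
    rw [coeff_lamDel, Polynomial.coeff_X_pow]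
    split_ifs <;> simp

lemma map_lamDel (w : ι → DiffPoly F σ) (P : (DiffPoly F ι)[X]) :
    (lamDel P).map (diffHom w : DiffPoly F ι →+* DiffPoly F σ) =
      lamDel (P.map (diffHom w : DiffPoly F ι →+* DiffPoly F σ)) := by
  ext1 n
  cases n <;> simp [coeff_lamDel, diffHom_del, Polynomial.coeff_X_mul]

/-! ### Brackets with a fixed first argument as derivations -/

/-- Summing over the variables of the fixed `q` gives a finite sum of derivations. It has the
prescribed values on exactly those variables, and these determine a derivation at `q`. This converts
the Master Formula into a derivation. -/
lemma sum_pderiv_eq_mkDerivation (f : ι × ℕ → (DiffPoly F ι)[X]) (q : DiffPoly F ι) :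
    ∑ j ∈ q.vars, C (MvPolynomial.pderiv j q) * f j = MvPolynomial.mkDerivation F f q := by
  classical
  let D : Derivation F (DiffPoly F ι) (DiffPoly F ι)[X] :=
    ∑ j ∈ q.vars, (LinearMap.toSpanSingleton (DiffPoly F ι) _ (f j)).compDer
      (MvPolynomial.pderiv j)
  have hD : ∀ p, D p = ∑ j ∈ q.vars, C (MvPolynomial.pderiv j p) * f j := by
    intro p
    have h := congrFun (map_sum (Derivation.coeFnAddMonoidHom (R := F) (A := DiffPoly F ι)
      (M := (DiffPoly F ι)[X])) (fun j => (LinearMap.toSpanSingleton (DiffPoly F ι) _ (f j)).compDer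
        (MvPolynomial.pderiv j)) q.vars) p
    refine h.trans ?_
    simp [Finset.sum_apply, Derivation.coeFnAddMonoidHom, Polynomial.smul_eq_C_mul]
  rw [← hD]
  refine MvPolynomial.derivation_eq_of_forall_mem_vars fun i hi => ?_
  rw [hD, MvPolynomial.mkDerivation_X, Finset.sum_eq_single_of_mem i hi]
  · simp
  · intro j _ hj
    rw [MvPolynomial.pderiv_X_of_ne hj.symm]; simp

/-- The derivation `E : V → V[λ]` with `E (∂ p) = (λ + ∂) E p` and prescribed values on the
generators. -/
def lamDer (h : ι → (DiffPoly F ι)[X]) : Derivation F (DiffPoly F ι) (DiffPoly F ι)[X] :=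
  MvPolynomial.mkDerivation F fun p => lamDel^[p.2] (h p.1)

lemma lamDer_mul (h : ι → (DiffPoly F ι)[X]) (p q : DiffPoly F ι) :
    lamDer h (p * q) = C p * lamDer h q + C q * lamDer h p := by
  simp only [Derivation.leibniz, Polynomial.smul_eq_C_mul]

lemma lamDer_X (h : ι → (DiffPoly F ι)[X]) (p : ι × ℕ) :
    lamDer h (MvPolynomial.X p) = lamDel^[p.2] (h p.1) := by
  simp [lamDer]

lemma lamDer_del (h : ι → (DiffPoly F ι)[X]) (p : DiffPoly F ι) :
    lamDer h (del p) = lamDel (lamDer h p) := by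
  induction p using MvPolynomial.induction_on with
  | C c => rw [MvPolynomial.derivation_C, MvPolynomial.derivation_C, map_zero, lamDel_zero]
  | add p q hp hq => simp only [map_add, hp, hq, lamDel_add]
  | mul_X p i hp =>
    rw [lamDer_mul, Derivation.leibniz, smul_eq_mul, smul_eq_mul, map_add, lamDer_mul, lamDer_mul,
      hp, lamDel_add, lamDel_C_mul, lamDel_C_mul, del_X, lamDer_X, lamDer_X,
      Function.iterate_succ_apply']
    ring

end DiffHom

/-! ### Brackets whose first argument lies in `g` -/

section Emb

variable {F : Type*} [Field F] {g : Type*} [LieRing g] [LieAlgebra F g]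
  {ι σ : Type*} (b : Module.Basis ι F g)

lemma emb_basis (i : ι) : emb b (b i) = MvPolynomial.X (i, 0) := by
  simp [emb]

lemma diffHom_emb (l : g →ₗ[F] DiffPoly F σ) (y : g) :
    diffHom (fun i => l (b i)) (emb b y) = l y := by
  have : (diffHom (fun i => l (b i))).toLinearMap ∘ₗ emb b = l :=
    b.ext fun i => by simp [emb_basis, diffHom_X]
  exact LinearMap.congr_fun this y

/-- The linear extension of `b ↦ {a _λ b}_z` from the generators. -/
def affineLin (κ : LinearMap.BilinForm F g) (s : g) (z : F) (a y : g) : (DiffPoly F ι)[X] :=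
  C (emb b ⁅a, y⁆) + C (MvPolynomial.C (κ a y)) * X + C (MvPolynomial.C (z * κ s ⁅a, y⁆))

lemma affineLin_add_right (κ : LinearMap.BilinForm F g) (s : g) (z : F) (a y y' : g) :
    affineLin b κ s z a (y + y') = affineLin b κ s z a y + affineLin b κ s z a y' := by
  simp only [affineLin, lie_add, map_add, mul_add, add_mul]
  abel

lemma affineLin_smul_right (κ : LinearMap.BilinForm F g) (s : g) (z c : F) (a y : g) :
    affineLin b κ s z a (c • y) = c • affineLin b κ s z a y := by
  have hp (p : DiffPoly F ι) : (C (c • p) : (DiffPoly F ι)[X]) = c • C p :=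
    (Polynomial.smul_C c p).symm
  have hc (r : F) : (C (MvPolynomial.C (c * r)) : (DiffPoly F ι)[X]) =
      c • C (MvPolynomial.C r) := by
    rw [map_mul, ← MvPolynomial.smul_eq_C_mul, hp]
  simp only [affineLin, lie_smul, map_smul, smul_eq_mul, mul_left_comm z c, smul_add, hp, hc,
    smul_mul_assoc]

lemma affineLin_add_left (κ : LinearMap.BilinForm F g) (s : g) (z : F) (a a' y : g) :
    affineLin b κ s z (a + a') y = affineLin b κ s z a y + affineLin b κ s z a' y := by
  simp only [affineLin, add_lie, map_add, mul_add, add_mul, LinearMap.add_apply]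
  abel

lemma affineLin_smul_left (κ : LinearMap.BilinForm F g) (s : g) (z c : F) (a y : g) :
    affineLin b κ s z (c • a) y = c • affineLin b κ s z a y := by
  have hp (p : DiffPoly F ι) : (C (c • p) : (DiffPoly F ι)[X]) = c • C p :=
    (Polynomial.smul_C c p).symm
  have hc (r : F) : (C (MvPolynomial.C (c * r)) : (DiffPoly F ι)[X]) =
      c • C (MvPolynomial.C r) := by
    rw [map_mul, ← MvPolynomial.smul_eq_C_mul, hp]
  simp only [affineLin, smul_lie, map_smul, smul_eq_mul, mul_left_comm z c, smul_add, hp, hc,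
    smul_mul_assoc, LinearMap.smul_apply]

lemma vars_emb (a : g) {p : ι × ℕ} (hp : p ∈ (emb b a).vars) : p.2 = 0 := by
  classical
  have h : emb b a ∈ MvPolynomial.supported F {p : ι × ℕ | p.2 = 0} := by
    rw [emb, Module.Basis.constr_apply]
    refine Subalgebra.sum_mem _ fun i _ => Subalgebra.smul_mem _ ?_ _
    exact MvPolynomial.X_mem_supported.mpr rfl
  exact MvPolynomial.mem_supported.mp h hp

lemma pderiv_emb (a : g) (i : ι) :
    MvPolynomial.pderiv (i, 0) (emb b a) = MvPolynomial.C (b.repr a i) := by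
  classical
  have : (MvPolynomial.pderiv (i, 0) : Derivation F (DiffPoly F ι) _).toLinearMap ∘ₗ emb b =
      Algebra.linearMap F _ ∘ₗ Finsupp.lapply i ∘ₗ b.repr.toLinearMap := by
    refine b.ext fun j => ?_
    simp only [LinearMap.comp_apply, Derivation.coeFn_coe, emb_basis,
      MvPolynomial.pderiv_X, LinearEquiv.coe_coe, Module.Basis.repr_self, Finsupp.lapply_apply,
      Algebra.linearMap_apply, MvPolynomial.algebraMap_eq, Finsupp.single_apply, Pi.single_apply,
      Prod.mk.injEq, and_true]
    split_ifs <;> simp_all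
  exact LinearMap.congr_fun this a

lemma applyLamDel_C (H : (DiffPoly F ι)[X]) (c : F) :
    applyLamDel H (C (MvPolynomial.C c)) = C (MvPolynomial.C c) * H := by
  rw [applyLamDel]
  conv_rhs => rw [← Polynomial.sum_C_mul_X_pow_eq H, Polynomial.sum_def, Finset.mul_sum]
  rw [Polynomial.sum_def]
  refine Finset.sum_congr rfl fun n _ => ?_
  rw [lamDel_iterate_C]; ring

/-- For `a ∈ g` only the variables `u_i^{(0)}` occur and the partial derivatives are scalars. Hence
`λ + ∂` inside the bracket has nothing to differentiate on its right, and the Master Formula reduces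
to a derivation in `q`. -/
lemma affineBracket_emb_left (κ : LinearMap.BilinForm F g) (s : g) (z : F) (a : g)
    (q : DiffPoly F ι) :
    affineBracket b κ s z (emb b a) q = lamDer (fun j => affineLin b κ s z a (b j)) q := by
  classical
  rw [lamDer, ← sum_pderiv_eq_mkDerivation, affineBracket, lambdaBracket]
  refine Finset.sum_congr rfl fun j _ => ?_
  rw [← Finset.mul_sum]
  congr 1
  have hsum (n : ℕ) (S : Finset (ι × ℕ)) (φ : ι × ℕ → (DiffPoly F ι)[X]) :
      ∑ i ∈ S, lamDel^[n] (φ i) = lamDel^[n] (∑ i ∈ S, φ i) := by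
    let A : (DiffPoly F ι)[X] →+ (DiffPoly F ι)[X] :=
      AddMonoidHom.mk' (lamDel^[n]) (lamDel_iterate_add n)
    exact (map_sum A φ S).symm
  rw [hsum]
  congr 1
  have hterm : ∀ p ∈ (emb b a).vars,
      applyLamDel (affineTable b κ s z p.1 j.1)
        ((fun P => -lamDel P)^[p.2] (C (MvPolynomial.pderiv p (emb b a)))) =
      C (MvPolynomial.pderiv p (emb b a)) * affineLin b κ s z (b p.1) (b j.1) := by
    rintro ⟨i, n⟩ hp
    obtain rfl : n = 0 := vars_emb b a hp
    simp only [Function.iterate_zero, id_eq, pderiv_emb, applyLamDel_C]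
    rfl
  -- The remaining sum over the variables of `a` is again a derivation, now evaluated at `a`; on `g`
  -- it is the linear extension from the basis.
  rw [Finset.sum_congr rfl hterm,
    sum_pderiv_eq_mkDerivation (fun p => affineLin b κ s z (b p.1) (b j.1))]
  let l : g →ₗ[F] (DiffPoly F ι)[X] :=
    { toFun := fun a => affineLin b κ s z a (b j.1)
      map_add' := fun _ _ => affineLin_add_left b κ s z _ _ _
      map_smul' := fun _ _ => affineLin_smul_left b κ s z _ _ _ }
  have : (MvPolynomial.mkDerivation F
      fun p : ι × ℕ => affineLin b κ s z (b p.1) (b j.1)).toLinearMap ∘ₗ emb b = l :=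
    b.ext fun i => by simp [emb_basis, l]
  exact LinearMap.congr_fun this a

lemma affineBracket_emb_emb (κ : LinearMap.BilinForm F g) (s : g) (z : F) (a y : g) :
    affineBracket b κ s z (emb b a) (emb b y) = affineLin b κ s z a y := by
  rw [affineBracket_emb_left]
  let l : g →ₗ[F] (DiffPoly F ι)[X] :=
    { toFun := fun y => affineLin b κ s z a y
      map_add' := fun _ _ => affineLin_add_right b κ s z _ _ _
      map_smul' := fun _ _ => affineLin_smul_right b κ s z _ _ _ }
  have : (lamDer fun j => affineLin b κ s z a (b j)).toLinearMap ∘ₗ emb b = l :=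
    b.ext fun i => by simp [emb_basis, l, lamDer_X]
  exact LinearMap.congr_fun this y

end Emb

/-! ### Short gradings and `sl₂` identities -/

section ShortGrading

variable {F : Type*} [Field F] [CharZero F] {g : Type*} [LieRing g] [LieAlgebra F g]

omit [CharZero F] in
lemma mem_gr {x y : g} {j : ℚ} : y ∈ gr F x j ↔ ⁅x, y⁆ = (j : F) • y := by
  simp [gr]

lemma lie_mem_gr {x y y' : g} {i j k : ℚ} (hk : i + j = k) (hy : y ∈ gr F x i)
    (hy' : y' ∈ gr F x j) : ⁅y, y'⁆ ∈ gr F x k := by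
  rw [mem_gr] at *
  rw [leibniz_lie, hy, hy', smul_lie, lie_smul, ← add_smul, ← hk, Rat.cast_add]

lemma iSupIndep_gr (x : g) : iSupIndep (gr F x) :=
  (Module.End.eigenspaces_iSupIndep (LieAlgebra.ad F g x)).comp
    (f := fun j : ℚ => (j : F)) Rat.cast_injective

/-- Eigenspaces are independent, and the three with eigenvalues `-1, 0, 1` already fill `g`. -/
lemma IsShort.gr_eq_bot {x : g} (h : IsShort F x) {j : ℚ} (h1 : j ≠ -1) (h2 : j ≠ 0)
    (h3 : j ≠ 1) : gr F x j = ⊥ := by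
  have hd := iSupIndep_gr (F := F) x j
  have htop : ⨆ i, ⨆ (_ : i ≠ j), gr F x i = ⊤ := by
    rw [eq_top_iff, ← h]
    exact sup_le (sup_le (le_iSup₂_of_le (-1) h1.symm le_rfl) (le_iSup₂_of_le 0 h2.symm le_rfl))
      (le_iSup₂_of_le 1 h3.symm le_rfl)
  rw [htop] at hd
  exact disjoint_top.mp hd

lemma IsShort.grGE_half {x : g} (h : IsShort F x) : grGE F x (1 / 2) = gr F x 1 := by
  refine le_antisymm (iSup₂_le fun j hj => ?_) (le_iSup₂_of_le 1 (by norm_num) le_rfl)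
  by_cases h1 : j = 1
  · rw [h1]
  · rw [h.gr_eq_bot (by linarith) (by linarith) h1]; exact bot_le

lemma IsShort.grLE_half {x : g} (h : IsShort F x) :
    grLE F x (1 / 2) = gr F x (-1) ⊔ gr F x 0 := by
  refine le_antisymm (iSup₂_le fun j hj => ?_)
    (sup_le (le_iSup₂_of_le (-1) (by norm_num) le_rfl) (le_iSup₂_of_le 0 (by norm_num) le_rfl))
  by_cases h1 : j = -1
  · rw [h1]; exact le_sup_left
  by_cases h2 : j = 0
  · rw [h2]; exact le_sup_right
  rw [h.gr_eq_bot h1 h2 (by linarith)]; exact bot_le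

lemma IsShort.projLE_of_mem {x y : g} (h : IsShort F x) (hy : y ∈ gr F x (-1) ⊔ gr F x 0) :
    projLE F x y = y := by
  rw [projLE, dif_pos (isCompl_of_isShort F x h)]
  rw [← h.grLE_half] at hy
  exact Submodule.projection_apply_of_mem_left _ hy

lemma IsShort.projLE_of_mem_one {x y : g} (h : IsShort F x) (hy : y ∈ gr F x 1) :
    projLE F x y = 0 := by
  rw [projLE, dif_pos (isCompl_of_isShort F x h)]
  refine Submodule.projection_apply_of_mem_right _ ?_
  exact (le_iSup₂_of_le 1 le_rfl le_rfl : gr F x 1 ≤ grGE F x 1) hy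

/-- A short `sl₂`-triple `{f, 2x, e}` together with an invariant symmetric bilinear form. -/
structure ShortTriple (κ : LinearMap.BilinForm F g) (e x f : g) : Prop where
  short : IsShort F x
  e_mem : e ∈ gr F x 1
  f_mem : f ∈ gr F x (-1)
  lie_e_f : ⁅e, f⁆ = (2 : F) • x
  symm : ∀ p q, κ p q = κ q p
  inv : ∀ p q r, κ ⁅p, q⁆ r = κ p ⁅q, r⁆

lemma ShortTriple.of_isSl2Triple {κ : LinearMap.BilinForm F g} {e x f : g} (hsymm : κ.IsSymm)
    (hinv : ∀ p q r : g, κ ⁅p, q⁆ r = κ p ⁅q, r⁆) (ht : IsSl2Triple ((2 : F) • x) e f)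
    (hshort : IsShort F x) : ShortTriple κ e x f where
  short := hshort
  e_mem := by
    have h := ht.lie_h_e_nsmul
    rw [smul_lie, ← Nat.cast_smul_eq_nsmul F, Nat.cast_ofNat] at h
    rw [mem_gr, Rat.cast_one, one_smul]
    exact smul_right_injective g (two_ne_zero (α := F)) h
  f_mem := by
    have h := ht.lie_h_f_nsmul
    rw [smul_lie, ← Nat.cast_smul_eq_nsmul F, Nat.cast_ofNat, ← smul_neg] at h
    rw [mem_gr, Rat.cast_neg, Rat.cast_one, neg_one_smul]
    exact smul_right_injective g (two_ne_zero (α := F)) h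
  lie_e_f := ht.lie_e_f
  symm p q := hsymm.eq p q
  inv := hinv

namespace ShortTriple

variable {κ : LinearMap.BilinForm F g} {e x f : g} (T : ShortTriple κ e x f)
include T

/-- Moving `ad x` across the invariant form multiplies `κ y y'` by `i + j` and gives zero. -/
lemma orthogonal {y y' : g} {i j : ℚ} (hy : y ∈ gr F x i) (hy' : y' ∈ gr F x j)
    (hij : i + j ≠ 0) : κ y y' = 0 := by
  rw [mem_gr] at hy hy'
  have h1 : κ ⁅y, x⁆ y' = κ y ⁅x, y'⁆ := T.inv _ _ _
  rw [← lie_skew, hy, hy', map_neg, map_smul, map_smul, LinearMap.neg_apply, LinearMap.smul_apply,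
    smul_eq_mul, smul_eq_mul] at h1
  have h2 : ((i + j : ℚ) : F) * κ y y' = 0 := by rw [Rat.cast_add]; linear_combination -h1
  exact (mul_eq_zero.mp h2).resolve_left (Rat.cast_ne_zero.mpr hij)

lemma lie_f_eq_zero {v : g} (hv : v ∈ gr F x (-1)) : ⁅f, v⁆ = 0 := by
  have h := lie_mem_gr (F := F) (k := -2) (by norm_num) T.f_mem hv
  rwa [T.short.gr_eq_bot (by norm_num) (by norm_num) (by norm_num), Submodule.mem_bot] at h

lemma lie_eq_zero_of_neg {v w : g} (hv : v ∈ gr F x (-1)) (hw : w ∈ gr F x (-1)) : ⁅v, w⁆ = 0 := by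
  have h := lie_mem_gr (F := F) (k := -2) (by norm_num) hv hw
  rwa [T.short.gr_eq_bot (by norm_num) (by norm_num) (by norm_num), Submodule.mem_bot] at h

lemma lie_e_eq_zero {a : g} (ha : a ∈ gr F x 1) : ⁅e, a⁆ = 0 := by
  have h := lie_mem_gr (F := F) (k := 2) (by norm_num) T.e_mem ha
  rwa [T.short.gr_eq_bot (by norm_num) (by norm_num) (by norm_num), Submodule.mem_bot] at h

lemma lie_f_lie_e {v : g} (hv : v ∈ gr F x (-1)) : ⁅f, ⁅e, v⁆⁆ = (2 : F) • v := by
  have h : ⁅f, e⁆ = -((2 : F) • x) := by rw [← lie_skew, T.lie_e_f]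
  rw [leibniz_lie, T.lie_f_eq_zero hv, lie_zero, add_zero, h, neg_lie, smul_lie, mem_gr.mp hv]
  simp

lemma lie_e_lie_f {a : g} (ha : a ∈ gr F x 1) : ⁅e, ⁅f, a⁆⁆ = (2 : F) • a := by
  rw [leibniz_lie, T.lie_e_eq_zero ha, lie_zero, add_zero, T.lie_e_f, smul_lie, mem_gr.mp ha]
  simp

lemma lie_e_mem {v : g} (hv : v ∈ gr F x (-1)) : ⁅e, v⁆ ∈ gr F x 0 :=
  lie_mem_gr (by norm_num) T.e_mem hv

lemma lie_f_mem {a : g} (ha : a ∈ gr F x 1) : ⁅f, a⁆ ∈ gr F x 0 :=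
  lie_mem_gr (by norm_num) T.f_mem ha

lemma lie_f_mem_of_zero {q : g} (hq : q ∈ gr F x 0) : ⁅f, q⁆ ∈ gr F x (-1) :=
  lie_mem_gr (by norm_num) T.f_mem hq

lemma jordan_mem {v w : g} (hv : v ∈ gr F x (-1)) (hw : w ∈ gr F x (-1)) :
    jordan e v w ∈ gr F x (-1) :=
  lie_mem_gr (by norm_num) (T.lie_e_mem hv) hw

lemma exists_eq_lie_e_lie_e {a : g} (ha : a ∈ gr F x 1) :
    ∃ w ∈ gr F x (-1), ⁅e, ⁅e, w⁆⁆ = a := by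
  -- On `g_1` the operator `(ad e)² (ad f)²` is multiplication by `4`.
  refine ⟨(1 / 4 : F) • ⁅f, ⁅f, a⁆⁆,
    Submodule.smul_mem _ _ (T.lie_f_mem_of_zero (T.lie_f_mem ha)), ?_⟩
  have h0 : ⁅x, ⁅f, a⁆⁆ = 0 := by simpa using mem_gr.mp (T.lie_f_mem ha)
  have h : ⁅e, ⁅f, ⁅f, a⁆⁆⁆ = (2 : F) • ⁅f, a⁆ := by
    rw [leibniz_lie, T.lie_e_f, smul_lie, h0, smul_zero, zero_add, T.lie_e_lie_f ha, lie_smul]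
  rw [lie_smul, lie_smul, h, lie_smul, T.lie_e_lie_f ha, smul_smul, smul_smul]
  norm_num

/-- The quadratic terms of `ψ` cancel because the Jordan product is commutative. -/
lemma jordan_identity {a v : g} (ha : a ∈ gr F x 1) (hv : v ∈ gr F x (-1)) :
    (-(1 / 2) : F) • ⁅e, ⁅⁅f, a⁆, v⁆⁆ + (1 / 8 : F) • ⁅e, jordan e v ⁅f, ⁅f, a⁆⁆⁆
      + (1 / 4 : F) • ⁅f, ⁅a, ⁅e, v⁆⁆⁆ = 0 := by
  -- In terms of `w` each summand is a multiple of `[e, [[e, w], v]]`, with coefficients `-1`, `1/2`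
  -- and `1/2`.
  obtain ⟨w, hw, rfl⟩ := T.exists_eq_lie_e_lie_e ha
  have h0 : ⁅x, ⁅e, w⁆⁆ = 0 := by simpa using mem_gr.mp (T.lie_e_mem hw)
  have h1 : ⁅f, ⁅e, ⁅e, w⁆⁆⁆ = (2 : F) • ⁅e, w⁆ := by
    have h : ⁅f, e⁆ = -((2 : F) • x) := by rw [← lie_skew, T.lie_e_f]
    rw [leibniz_lie, h, neg_lie, smul_lie, h0, T.lie_f_lie_e hw, lie_smul]
    simp
  have h2 : ⁅f, ⁅f, ⁅e, ⁅e, w⁆⁆⁆⁆ = (4 : F) • w := by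
    rw [h1, lie_smul, T.lie_f_lie_e hw, smul_smul]; norm_num
  -- The Jacobi identity applied to `[e, [v, w]]`, which vanishes because `g_{-2} = 0`.
  have hcomm : jordan e v w = ⁅⁅e, w⁆, v⁆ := by
    have h := leibniz_lie e v w
    rw [T.lie_eq_zero_of_neg hv hw, lie_zero, ← lie_skew v] at h
    rw [jordan]
    exact (eq_neg_of_add_eq_zero_left h.symm).trans (neg_neg _)
  have h3 : ⁅f, ⁅⁅e, ⁅e, w⁆⁆, ⁅e, v⁆⁆⁆ = (2 : F) • ⁅e, ⁅⁅e, w⁆, v⁆⁆ := by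
    rw [leibniz_lie f, h1, T.lie_f_lie_e hv, smul_lie, lie_smul, ← smul_add, leibniz_lie e ⁅e, w⁆ v,
      add_comm]
  have h4 : jordan e v ((4 : F) • w) = (4 : F) • ⁅⁅e, w⁆, v⁆ := by
    rw [← hcomm, jordan, jordan, lie_smul]
  rw [h2, h4, h1, h3, smul_lie, lie_smul, lie_smul]
  module

/-- Through this pairing `g_1` detects `[e, g_{-1}]`; it is the source of the factor `-2` in the
adapted coordinates. -/
lemma form_f_lie_lie_e {a v : g} (hv : v ∈ gr F x (-1)) :
    κ f ⁅a, ⁅e, v⁆⁆ = -2 * κ a v := by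
  rw [← T.inv, ← lie_skew, map_neg, LinearMap.neg_apply, T.inv, T.lie_f_lie_e hv, map_smul,
    smul_eq_mul]
  ring

end ShortTriple

end ShortGrading

/-! ### The operator `p ↦ ρ{a_λ p}_z` and the W-algebra as its common kernel -/

section ReducedBracket

variable {F : Type*} [Field F] [CharZero F] {g : Type*} [LieRing g] [LieAlgebra F g]
  {ι : Type*} (b : Module.Basis ι F g)

omit [CharZero F] in
lemma emb_mem_subLE {x y : g} (hy : y ∈ grLE F x (1 / 2)) : emb b y ∈ subLE b x :=
  Algebra.subset_adjoin ⟨y, hy, 0, rfl⟩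

omit [CharZero F] in
lemma rho_eq_diffHom (κ : LinearMap.BilinForm F g) (x f : g) :
    rho b κ x f =
      diffHom fun i => (emb b ∘ₗ projLE F x + Algebra.linearMap F (DiffPoly F ι) ∘ₗ κ f) (b i) :=
  rfl

omit [CharZero F] in
lemma rho_emb (κ : LinearMap.BilinForm F g) (x f y : g) :
    rho b κ x f (emb b y) = emb b (projLE F x y) + MvPolynomial.C (κ f y) := by
  rw [rho_eq_diffHom, diffHom_emb]; rfl

omit [CharZero F] in
lemma del_mem_subLE {x : g} {p : DiffPoly F ι} (hp : p ∈ subLE b x) : del p ∈ subLE b x := by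
  refine Algebra.adjoin_induction ?_ ?_ ?_ ?_ hp
  · rintro _ ⟨a, ha, n, rfl⟩
    exact Algebra.subset_adjoin ⟨a, ha, n + 1, (Function.iterate_succ_apply' _ _ _).symm⟩
  · intro r
    rw [Derivation.map_algebraMap]; exact zero_mem _
  · intro p q _ _ hp hq
    rw [map_add]; exact add_mem hp hq
  · intro p q hp' hq' hp hq
    rw [Derivation.leibniz]
    exact add_mem (mul_mem hp' hq) (mul_mem hq' hp)

omit [CharZero F] in
lemma del_iterate_mem_subLE {x : g} {p : DiffPoly F ι} (hp : p ∈ subLE b x) (n : ℕ) :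
    del^[n] p ∈ subLE b x := by
  induction n with
  | zero => exact hp
  | succ n ih => rw [Function.iterate_succ_apply']; exact del_mem_subLE b ih

/-- The operator `p ↦ ρ {a _λ p}_z`. -/
def redBracket (κ : LinearMap.BilinForm F g) (x f s : g) (z : F) (a : g) :
    DiffPoly F ι →ₗ[F] (DiffPoly F ι)[X] :=
  (Polynomial.mapAlgHom (rho b κ x f)).toLinearMap ∘ₗ
    (lamDer fun j => affineLin b κ s z a (b j)).toLinearMap

omit [CharZero F] in
lemma redBracket_apply (κ : LinearMap.BilinForm F g) (x f s : g) (z : F) (a : g)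
    (p : DiffPoly F ι) : redBracket b κ x f s z a p =
      (lamDer (fun j => affineLin b κ s z a (b j)) p).map
        (rho b κ x f : DiffPoly F ι →+* DiffPoly F ι) :=
  rfl

variable (κ : LinearMap.BilinForm F g) (x f s : g) (z : F) (a : g)

omit [CharZero F] in
lemma redBracket_mul (p q : DiffPoly F ι) : redBracket b κ x f s z a (p * q) =
    C (rho b κ x f p) * redBracket b κ x f s z a q
      + C (rho b κ x f q) * redBracket b κ x f s z a p := by
  simp only [redBracket_apply, lamDer_mul, Polynomial.map_add, Polynomial.map_mul,
    Polynomial.map_C, RingHom.coe_coe]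

omit [CharZero F] in
lemma redBracket_algebraMap (c : F) :
    redBracket b κ x f s z a (algebraMap F (DiffPoly F ι) c) = 0 := by
  rw [redBracket_apply, Derivation.map_algebraMap, Polynomial.map_zero]

omit [CharZero F] in
lemma redBracket_del (p : DiffPoly F ι) :
    redBracket b κ x f s z a (del p) = lamDel (redBracket b κ x f s z a p) := by
  rw [redBracket_apply, lamDer_del, rho_eq_diffHom, map_lamDel]; rfl

omit [CharZero F] in
lemma redBracket_del_iterate (n : ℕ) (p : DiffPoly F ι) :
    redBracket b κ x f s z a (del^[n] p) = lamDel^[n] (redBracket b κ x f s z a p) := by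
  induction n with
  | zero => rfl
  | succ n ih => rw [Function.iterate_succ_apply', redBracket_del, ih, Function.iterate_succ_apply']

omit [CharZero F] in
lemma redBracket_emb (y : g) : redBracket b κ x f s z a (emb b y) =
    C (emb b (projLE F x ⁅a, y⁆) + MvPolynomial.C (κ f ⁅a, y⁆))
      + C (MvPolynomial.C (κ a y)) * X + C (MvPolynomial.C (z * κ s ⁅a, y⁆)) := by
  have hC (r : F) : rho b κ x f (MvPolynomial.C r) = MvPolynomial.C r := by
    rw [← MvPolynomial.algebraMap_eq]; exact AlgHom.commutes _ _
  rw [redBracket_apply, ← affineBracket_emb_left, affineBracket_emb_emb, affineLin]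
  simp only [Polynomial.map_add, Polynomial.map_mul, Polynomial.map_C, Polynomial.map_X,
    RingHom.coe_coe, rho_emb, hC]

variable {κ x f s}

/-- The element `f ∈ g_{-1}` is orthogonal to `g_{-1} ⊕ g_0`, so `ρ` fixes the generators. Hence the
twisted Leibniz rule `redBracket_mul` is the ordinary one on `V(g_{≤1/2})`. -/
lemma rho_of_mem_subLE {e : g} (T : ShortTriple κ e x f) {p : DiffPoly F ι}
    (hp : p ∈ subLE b x) : rho b κ x f p = p := by
  have h : subLE b x ≤ AlgHom.equalizer (rho b κ x f) (AlgHom.id F _) := by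
    refine Algebra.adjoin_le ?_
    rintro _ ⟨y, hy, n, rfl⟩
    rw [T.short.grLE_half] at hy
    have h0 : κ f y = 0 := by
      obtain ⟨v, hv, q, hq, rfl⟩ := Submodule.mem_sup.mp hy
      rw [map_add, T.orthogonal T.f_mem hv (by norm_num), T.orthogonal T.f_mem hq (by norm_num),
        add_zero]
    change rho b κ x f _ = del^[n] (emb b y)
    rw [rho_eq_diffHom, diffHom_del_iterate, ← rho_eq_diffHom, rho_emb, T.short.projLE_of_mem hy,
      h0, map_zero, add_zero]
  exact h hp

lemma mem_wAlgebra_iff (h : IsShort F x) {p : DiffPoly F ι} : p ∈ wAlgebra b κ x f s z ↔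
    p ∈ subLE b x ∧ ∀ a ∈ gr F x 1, redBracket b κ x f s z a p = 0 := by
  simp only [wAlgebra, Set.mem_ofPred_eq, h.grGE_half, affineBracket_emb_left, redBracket_apply]

variable (κ f s) in
/-- The classical W-algebra as a subalgebra. -/
def wSubalgebra (h : IsShort F x) : Subalgebra F (DiffPoly F ι) where
  carrier := wAlgebra b κ x f s z
  mul_mem' := by
    intro p q hp hq
    rw [mem_wAlgebra_iff b z h] at *
    refine ⟨mul_mem hp.1 hq.1, fun a ha => ?_⟩
    rw [redBracket_mul, hp.2 a ha, hq.2 a ha, mul_zero, mul_zero, add_zero]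
  add_mem' := by
    intro p q hp hq
    rw [mem_wAlgebra_iff b z h] at *
    refine ⟨add_mem hp.1 hq.1, fun a ha => ?_⟩
    rw [map_add, hp.2 a ha, hq.2 a ha, add_zero]
  algebraMap_mem' := by
    intro c
    rw [mem_wAlgebra_iff b z h]
    exact ⟨Subalgebra.algebraMap_mem _ c, fun a _ => redBracket_algebraMap b κ x f s z a c⟩

lemma mem_wSubalgebra_iff (h : IsShort F x) {p : DiffPoly F ι} :
    p ∈ wSubalgebra b κ f s z h ↔
      p ∈ subLE b x ∧ ∀ a ∈ gr F x 1, redBracket b κ x f s z a p = 0 :=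
  mem_wAlgebra_iff b z h

lemma del_iterate_mem_wSubalgebra (h : IsShort F x) {p : DiffPoly F ι}
    (hp : p ∈ wSubalgebra b κ f s z h) (n : ℕ) : del^[n] p ∈ wSubalgebra b κ f s z h := by
  induction n with
  | zero => exact hp
  | succ n ih =>
    rw [Function.iterate_succ_apply']
    rw [mem_wSubalgebra_iff] at ih ⊢
    refine ⟨del_mem_subLE b ih.1, fun a ha => ?_⟩
    rw [redBracket_del, ih.2 a ha, lamDel_zero]

namespace ShortTriple

variable {e : g} (T : ShortTriple κ e x f)
include T

lemma mem_subLE_of_neg {v : g} (hv : v ∈ gr F x (-1)) : emb b v ∈ subLE b x :=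
  emb_mem_subLE b (T.short.grLE_half ▸ Submodule.mem_sup_left hv)

lemma mem_subLE_of_zero {q : g} (hq : q ∈ gr F x 0) : emb b q ∈ subLE b x :=
  emb_mem_subLE b (T.short.grLE_half ▸ Submodule.mem_sup_right hq)

variable {a}

lemma redBracket_emb_zero (hs : s ∈ gr F x 1) (ha : a ∈ gr F x 1) {q : g} (hq : q ∈ gr F x 0) :
    redBracket b κ x f s z a (emb b q) = C (MvPolynomial.C (κ f ⁅a, q⁆)) := by
  have h : ⁅a, q⁆ ∈ gr F x 1 := lie_mem_gr (by norm_num) ha hq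
  -- Here `[a, q] ∈ g_1` is killed by the projection and orthogonal to `s ∈ g_1`, so only its
  -- pairing with `f` survives.
  rw [redBracket_emb, T.short.projLE_of_mem_one h, T.orthogonal ha hq (by norm_num),
    T.orthogonal hs h (by norm_num)]
  simp

lemma redBracket_emb_neg (hs : s ∈ gr F x 1) (ha : a ∈ gr F x 1) {v : g} (hv : v ∈ gr F x (-1)) :
    redBracket b κ x f s z a (emb b v) = C (emb b ⁅a, v⁆) + C (MvPolynomial.C (κ a v)) * X := by
  have h : ⁅a, v⁆ ∈ gr F x 0 := lie_mem_gr (by norm_num) ha hv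
  rw [redBracket_emb, T.short.projLE_of_mem (Submodule.mem_sup_right h),
    T.orthogonal T.f_mem h (by norm_num), T.orthogonal hs h (by norm_num)]
  simp

lemma redBracket_emb_mul_emb (hs : s ∈ gr F x 1) (ha : a ∈ gr F x 1) {q q' : g}
    (hq : q ∈ gr F x 0) (hq' : q' ∈ gr F x 0) :
    redBracket b κ x f s z a (emb b q * emb b q') =
      C (emb b (κ f ⁅a, q'⁆ • q + κ f ⁅a, q⁆ • q')) := by
  rw [redBracket_mul, T.redBracket_emb_zero b z hs ha hq, T.redBracket_emb_zero b z hs ha hq',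
    rho_of_mem_subLE b T (T.mem_subLE_of_zero b hq),
    rho_of_mem_subLE b T (T.mem_subLE_of_zero b hq'), ← map_mul, ← map_mul, ← map_add,
    map_add (emb b), map_smul (emb b), map_smul (emb b), MvPolynomial.smul_eq_C_mul, MvPolynomial.smul_eq_C_mul,
    mul_comm (emb b q), mul_comm (emb b q')]

end ShortTriple

end ReducedBracket

/-! ### Invariance of `ψ(v)` -/

section Psi

variable {F : Type*} [Field F] [CharZero F] {g : Type*} [LieRing g] [LieAlgebra F g]
  {κ : LinearMap.BilinForm F g} {e x f : g} (T : ShortTriple κ e x f)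
  {K : Type*} [Fintype K] [DecidableEq K]
  (u : Module.Basis K F (gr F x (-1))) (ud : Module.Basis K F (gr F x 1))
  (hdual : ∀ k l, κ (u k) (ud l) = if k = l then 1 else 0)

omit [CharZero F] in
include hdual in
-- The expansion `a = ∑ (a | u_k) u^k`, pushed through a linear map.
lemma sum_form_smul_dual (hsymm : ∀ p q, κ p q = κ q p)
    {M : Type*} [AddCommGroup M] [Module F M] (L : g →ₗ[F] M) {a : g}
    (ha : a ∈ gr F x 1) : ∑ k, κ a (u k) • L (ud k) = L a := by
  have h : (∑ k, ud.repr ⟨a, ha⟩ k • (ud k : g)) = a := by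
    have := congrArg Subtype.val (ud.sum_repr ⟨a, ha⟩)
    rwa [Submodule.coe_sum] at this
  have hk : ∀ k, κ a (u k) = ud.repr ⟨a, ha⟩ k := by
    intro k
    conv_lhs => rw [hsymm, ← h]
    simp [hdual]
  conv_rhs => rw [← h]
  simp [hk]

omit [CharZero F] in
include hdual in
lemma sum_form_smul {M : Type*} [AddCommGroup M] [Module F M] (L : g →ₗ[F] M) {w : g}
    (hw : w ∈ gr F x (-1)) : ∑ k, κ w (ud k) • L (u k) = L w := by
  have h : (∑ k, u.repr ⟨w, hw⟩ k • (u k : g)) = w := by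
    have := congrArg Subtype.val (u.sum_repr ⟨w, hw⟩)
    rwa [Submodule.coe_sum] at this
  have hk : ∀ k, κ w (ud k) = u.repr ⟨w, hw⟩ k := by
    intro k
    conv_lhs => rw [← h]
    simp [hdual]
  conv_rhs => rw [← h]
  simp [hk]

variable {ι : Type*} (b : Module.Basis ι F g) {s : g} (z : F)

include T hdual in
-- On each product in `ψ(v)` one factor becomes a scalar, and invariance of the form rewrites that
-- scalar as a pairing with `u_k` or `u^k`, so dual bases collapse the sums. The term `[v, a]` from
-- the first sum cancels the `[a, v]` coming from `v`.
lemma redBracket_psi (hs : s ∈ gr F x 1) {a v : g} (ha : a ∈ gr F x 1) (hv : v ∈ gr F x (-1)) :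
    redBracket b κ x f s z a (psi b e f (fun k => (u k : g)) (fun k => (ud k : g)) v) = 0 := by
  have hfa := T.lie_f_mem ha
  have hud (k : K) : ⁅v, (ud k : g)⁆ ∈ gr F x 0 := lie_mem_gr (by norm_num) hv (ud k).2
  have h1 : redBracket b κ x f s z a (∑ k, emb b ⁅v, (ud k : g)⁆ * emb b ⁅e, (u k : g)⁆) =
      C (emb b ((-2 : F) • ⁅v, a⁆ + ⁅e, ⁅⁅f, a⁆, v⁆⁆)) := by
    rw [map_sum, Finset.sum_congr rfl fun k _ => T.redBracket_emb_mul_emb b z hs ha (hud k)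
      (T.lie_e_mem (u k).2), ← map_sum, ← map_sum]
    congr 2
    rw [Finset.sum_add_distrib]
    congr 1
    · rw [Finset.sum_congr rfl fun k _ => by rw [T.form_f_lie_lie_e (u k).2, mul_smul],
        ← Finset.smul_sum]
      congr 1
      exact sum_form_smul_dual u ud hdual T.symm (LieAlgebra.ad F g v : g →ₗ[F] g) ha
    · rw [Finset.sum_congr rfl fun k _ => by rw [← T.inv, ← T.inv]]
      exact sum_form_smul u ud hdual (LieAlgebra.ad F g e : g →ₗ[F] g)
        (lie_mem_gr (by norm_num) hfa hv)
  have h2 : redBracket b κ x f s z a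
      (∑ k, emb b ⁅f, (ud k : g)⁆ * emb b ⁅e, jordan e v (u k : g)⁆) =
      C (emb b ((-2 : F) • ⁅f, ⁅a, ⁅e, v⁆⁆⁆ - ⁅e, jordan e v ⁅f, ⁅f, a⁆⁆⁆)) := by
    rw [map_sum, Finset.sum_congr rfl fun k _ => T.redBracket_emb_mul_emb b z hs ha
      (T.lie_f_mem (ud k).2) (T.lie_e_mem (T.jordan_mem hv (u k).2)), ← map_sum, ← map_sum]
    congr 2
    rw [Finset.sum_add_distrib, sub_eq_add_neg]
    congr 1
    · rw [Finset.sum_congr rfl fun k _ => by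
        rw [T.form_f_lie_lie_e (T.jordan_mem hv (u k).2), mul_smul, jordan, ← T.inv],
        ← Finset.smul_sum]
      congr 1
      exact sum_form_smul_dual u ud hdual T.symm (LieAlgebra.ad F g f : g →ₗ[F] g)
        (lie_mem_gr (by norm_num) ha (T.lie_e_mem hv))
    · have hsum := sum_form_smul u ud hdual ((LieAlgebra.ad F g e : g →ₗ[F] g) ∘ₗ
        (LieAlgebra.ad F g ⁅e, v⁆ : g →ₗ[F] g)) (T.lie_f_mem_of_zero hfa)
      refine Eq.trans ?_ (congrArg Neg.neg hsum)
      rw [← Finset.sum_neg_distrib]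
      refine Finset.sum_congr rfl fun k _ => ?_
      rw [← T.inv, ← T.inv, ← lie_skew ⁅f, a⁆ f, map_neg, LinearMap.neg_apply, neg_smul]
      rfl
  -- The bracket with `[e, v]` is a scalar, so `∂` only multiplies it by `λ`. With the factor `1/2`
  -- this cancels the term `(a | v) λ` of `v`.
  have h3 : redBracket b κ x f s z a (del (emb b ⁅e, v⁆)) =
      C (MvPolynomial.C (-2 * κ a v)) * X := by
    rw [redBracket_del, T.redBracket_emb_zero b z hs ha (T.lie_e_mem hv),
      T.form_f_lie_lie_e hv]
    simpa using lamDel_iterate_C (ι := ι) 1 (-2 * κ a v)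
  have hC (c : F) (p : DiffPoly F ι) : c • (C p : (DiffPoly F ι)[X]) = C (c • p) :=
    Polynomial.smul_C c p
  have hX : (1 / 2 : F) • (C (MvPolynomial.C (-2 * κ a v)) * X : (DiffPoly F ι)[X]) =
      (-1 : F) • (C (MvPolynomial.C (κ a v)) * X) := by
    rw [← smul_mul_assoc, ← smul_mul_assoc, hC, hC, MvPolynomial.smul_eq_C_mul,
      MvPolynomial.smul_eq_C_mul, ← map_mul, ← map_mul]
    congr 3
    ring
  change redBracket b κ x f s z a (_ - _ - _ + _) = 0
  rw [map_add (redBracket b κ x f s z a), map_sub (redBracket b κ x f s z a),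
    map_sub (redBracket b κ x f s z a), map_smul (redBracket b κ x f s z a),
    map_smul (redBracket b κ x f s z a), map_smul (redBracket b κ x f s z a), h1, h2, h3,
    T.redBracket_emb_neg b z hs ha hv, hX, hC, hC, ← map_smul (emb b), ← map_smul (emb b)]
  -- All terms of degree zero in `λ`, collected inside `g_0`.
  have hfin : ⁅a, v⁆ - (1 / 2 : F) • ((-2 : F) • ⁅v, a⁆ + ⁅e, ⁅⁅f, a⁆, v⁆⁆)
      - (1 / 8 : F) • ((-2 : F) • ⁅f, ⁅a, ⁅e, v⁆⁆⁆ - ⁅e, jordan e v ⁅f, ⁅f, a⁆⁆⁆) = 0 := by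
    rw [← T.jordan_identity ha hv, ← lie_skew v a]
    module
  have hC0 := congrArg (fun y => (C (emb b y) : (DiffPoly F ι)[X])) hfin
  rw [map_sub (emb b), map_sub (emb b), map_sub C, map_sub C, map_zero, map_zero] at hC0
  rw [← hC0]
  module

include T in
omit [DecidableEq K] in
lemma psi_mem_subLE {v : g} (hv : v ∈ gr F x (-1)) :
    psi b e f (fun k => (u k : g)) (fun k => (ud k : g)) v ∈ subLE b x := by
  change (_ - _ - _ + _ : DiffPoly F ι) ∈ _
  refine add_mem (sub_mem (sub_mem (T.mem_subLE_of_neg b hv) ?_) ?_) ?_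
  · refine Subalgebra.smul_mem _ (sum_mem fun k _ => mul_mem ?_ ?_) _
    · exact T.mem_subLE_of_zero b (lie_mem_gr (by norm_num) hv (ud k).2)
    · exact T.mem_subLE_of_zero b (T.lie_e_mem (u k).2)
  · refine Subalgebra.smul_mem _ (sum_mem fun k _ => mul_mem ?_ ?_) _
    · exact T.mem_subLE_of_zero b (T.lie_f_mem (ud k).2)
    · exact T.mem_subLE_of_zero b (T.lie_e_mem (T.jordan_mem hv (u k).2))
  · exact Subalgebra.smul_mem _ (del_mem_subLE b (T.mem_subLE_of_zero b (T.lie_e_mem hv))) _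

include T hdual in
lemma psi_mem_wSubalgebra (hs : s ∈ gr F x 1) {v : g} (hv : v ∈ gr F x (-1)) :
    psi b e f (fun k => (u k : g)) (fun k => (ud k : g)) v ∈
      wSubalgebra b κ f s z T.short := by
  rw [mem_wSubalgebra_iff]
  exact ⟨psi_mem_subLE T u ud b hv, fun a ha => redBracket_psi T u ud hdual b z hs ha hv⟩

end Psi

/-! ### Projections as interpolation polynomials in `ad x`, and `g_0 = g_0^f ⊕ [e, g_{-1}]` -/

section Projections

variable {F : Type*} [Field F] [CharZero F] {g : Type*} [LieRing g] [LieAlgebra F g]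

variable (F) in
/-- The projection on `g_0` for a short grading. -/
def zeroPart (x : g) : g →ₗ[F] g := 1 - LieAlgebra.ad F g x * LieAlgebra.ad F g x

variable (F) in
/-- The projection on `g_{-1}` for a short grading. -/
def negPart (x : g) : g →ₗ[F] g :=
  (1 / 2 : F) • (LieAlgebra.ad F g x * LieAlgebra.ad F g x - LieAlgebra.ad F g x)

omit [CharZero F] in
lemma zeroPart_apply (x y : g) : zeroPart F x y = y - ⁅x, ⁅x, y⁆⁆ := rfl

omit [CharZero F] in
lemma negPart_apply (x y : g) : negPart F x y = (1 / 2 : F) • (⁅x, ⁅x, y⁆⁆ - ⁅x, y⁆) := rfl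

omit [CharZero F] in
lemma zeroPart_of_mem_zero {x q : g} (hq : q ∈ gr F x 0) : zeroPart F x q = q := by
  simp [zeroPart_apply, mem_gr.mp hq]

omit [CharZero F] in
lemma negPart_of_mem_zero {x q : g} (hq : q ∈ gr F x 0) : negPart F x q = 0 := by
  simp [negPart_apply, mem_gr.mp hq]

omit [CharZero F] in
lemma zeroPart_of_mem_neg {x v : g} (hv : v ∈ gr F x (-1)) : zeroPart F x v = 0 := by
  simp [zeroPart_apply, mem_gr.mp hv]

lemma negPart_of_mem_neg {x v : g} (hv : v ∈ gr F x (-1)) : negPart F x v = v := by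
  have h : ⁅x, v⁆ = (-1 : F) • v := by simpa using mem_gr.mp hv
  rw [negPart_apply, h, lie_smul, h]
  module

omit [CharZero F] in
lemma zeroPart_of_mem_one {x v : g} (hv : v ∈ gr F x 1) : zeroPart F x v = 0 := by
  simp [zeroPart_apply, mem_gr.mp hv]

omit [CharZero F] in
lemma negPart_of_mem_one {x v : g} (hv : v ∈ gr F x 1) : negPart F x v = 0 := by
  simp [negPart_apply, mem_gr.mp hv]

omit [CharZero F] in
lemma IsShort.exists_decomposition {x : g} (h : IsShort F x) (y : g) :
    ∃ v ∈ gr F x (-1), ∃ q ∈ gr F x 0, ∃ a ∈ gr F x 1, v + q + a = y := by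
  have hy : y ∈ gr F x (-1) ⊔ gr F x 0 ⊔ gr F x 1 := h ▸ Submodule.mem_top
  obtain ⟨r, hr, a, ha, rfl⟩ := Submodule.mem_sup.mp hy
  obtain ⟨v, hv, q, hq, rfl⟩ := Submodule.mem_sup.mp hr
  exact ⟨v, hv, q, hq, a, ha, rfl⟩

omit [CharZero F] in
lemma IsShort.zeroPart_mem {x : g} (h : IsShort F x) (y : g) : zeroPart F x y ∈ gr F x 0 := by
  obtain ⟨v, hv, q, hq, a, ha, rfl⟩ := h.exists_decomposition y
  rw [map_add, map_add, zeroPart_of_mem_neg hv, zeroPart_of_mem_zero hq, zeroPart_of_mem_one ha]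
  simpa using hq

lemma IsShort.negPart_mem {x : g} (h : IsShort F x) (y : g) : negPart F x y ∈ gr F x (-1) := by
  obtain ⟨v, hv, q, hq, a, ha, rfl⟩ := h.exists_decomposition y
  rw [map_add, map_add, negPart_of_mem_neg hv, negPart_of_mem_zero hq, negPart_of_mem_one ha]
  simpa using hv

namespace ShortTriple

variable {κ : LinearMap.BilinForm F g} {e x f : g} (T : ShortTriple κ e x f)
include T

/-- The component in `g_{-1}`. -/
def negComp : g →ₗ[F] gr F x (-1) := (negPart F x).codRestrict _ T.short.negPart_mem

/-- The coefficient `w` in the decomposition `c + [e, w]` of the component in `g_0`, where `c`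
centralizes `f`. -/
def lieComp : g →ₗ[F] gr F x (-1) :=
  -- `ad f` kills the centralizer part, and `[f, [e, w]] = 2w`.
  ((1 / 2 : F) • ((LieAlgebra.ad F g f : g →ₗ[F] g) ∘ₗ zeroPart F x)).codRestrict _ fun y =>
    Submodule.smul_mem _ _ (T.lie_f_mem_of_zero (T.short.zeroPart_mem y))

lemma coe_lieComp (y : g) : (T.lieComp y : g) = (1 / 2 : F) • ⁅f, zeroPart F x y⁆ := rfl

/-- The component in `g_0^f` along `[e, g_{-1}] ⊕ g_{-1} ⊕ g_1`. -/
def centComp : g →ₗ[F] gr0Cent F x f :=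
  (zeroPart F x - (LieAlgebra.ad F g e : g →ₗ[F] g) ∘ₗ
    (gr F x (-1)).subtype ∘ₗ T.lieComp).codRestrict _ fun y => by
    have h0 := T.short.zeroPart_mem y
    refine ⟨sub_mem h0 (T.lie_e_mem (T.lieComp y).2), ?_⟩
    change ⁅f, zeroPart F x y - ⁅e, (T.lieComp y : g)⁆⁆ = 0
    rw [lie_sub, T.lie_f_lie_e (T.lieComp y).2, coe_lieComp, smul_smul]
    simp

lemma coe_centComp (y : g) :
    (T.centComp y : g) = zeroPart F x y - ⁅e, (T.lieComp y : g)⁆ := rfl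

lemma centComp_add {q : g} (hq : q ∈ gr F x 0) : (T.centComp q : g) + ⁅e, (T.lieComp q : g)⁆ = q := by
  rw [coe_centComp, zeroPart_of_mem_zero hq, sub_add_cancel]

lemma lieComp_coe (c : gr0Cent F x f) : T.lieComp c = 0 := by
  ext1
  rw [coe_lieComp, zeroPart_of_mem_zero c.2.1, show ⁅f, (c : g)⁆ = 0 from c.2.2]
  simp

lemma centComp_coe (c : gr0Cent F x f) : T.centComp c = c := by
  ext1
  rw [coe_centComp, lieComp_coe, zeroPart_of_mem_zero c.2.1]
  simp

lemma lieComp_lie_e (w : gr F x (-1)) : T.lieComp ⁅e, (w : g)⁆ = w := by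
  ext1
  rw [coe_lieComp, zeroPart_of_mem_zero (T.lie_e_mem w.2), T.lie_f_lie_e w.2, smul_smul]
  simp

lemma centComp_lie_e (w : gr F x (-1)) : T.centComp ⁅e, (w : g)⁆ = 0 := by
  ext1
  rw [coe_centComp, lieComp_lie_e, zeroPart_of_mem_zero (T.lie_e_mem w.2)]
  simp

lemma lieComp_of_mem_neg {v : g} (hv : v ∈ gr F x (-1)) : T.lieComp v = 0 := by
  ext1
  rw [coe_lieComp, zeroPart_of_mem_neg hv]
  simp

lemma centComp_of_mem_neg {v : g} (hv : v ∈ gr F x (-1)) : T.centComp v = 0 := by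
  ext1
  rw [coe_centComp, zeroPart_of_mem_neg hv, T.lieComp_of_mem_neg hv]
  simp

lemma negComp_of_mem_zero {q : g} (hq : q ∈ gr F x 0) : T.negComp q = 0 := by
  ext1
  exact negPart_of_mem_zero hq

lemma negComp_coe (w : gr F x (-1)) : T.negComp w = w := by
  ext1
  exact negPart_of_mem_neg w.2

end ShortTriple

end Projections

/-- If the variable occurred in a monomial `d`, the derivative would have a coefficient equal to
that of `d` times a positive integer, which is nonzero in characteristic zero. -/
lemma notMem_vars_of_pderiv_eq_zero {F σ : Type*} [Field F] [CharZero F]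
    {P : MvPolynomial σ F} {i : σ} (h : MvPolynomial.pderiv i P = 0) : i ∉ P.vars := by
  intro hi
  obtain ⟨d, hd, hid⟩ := (MvPolynomial.mem_vars_iff_mem_support i).mp hi
  have hc := MvPolynomial.coeff_pderiv (i := i) P (d - Finsupp.single i 1)
  rw [h, MvPolynomial.coeff_zero, tsub_add_cancel_of_le (Finsupp.single_le_iff.mpr
    (Nat.one_le_iff_ne_zero.mpr (Finsupp.mem_support_iff.mp hid)))] at hc
  have hne : MvPolynomial.coeff d P ≠ 0 := MvPolynomial.mem_support_iff.mp hd
  refine absurd hc.symm (mul_ne_zero hne ?_)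
  exact Nat.cast_add_one_ne_zero _

/-! ### Adapted generators of `V(g_{≤1/2})` -/

section Coordinates

variable {F : Type*} [Field F] [CharZero F] {g : Type*} [LieRing g] [LieAlgebra F g]
  {κ : LinearMap.BilinForm F g} {e x f : g} (T : ShortTriple κ e x f)
  {I : Type*} (c : Module.Basis I F (gr0Cent F x f))
  {K : Type*} [Fintype K]
  (u : Module.Basis K F (gr F x (-1))) (ud : Module.Basis K F (gr F x 1))
  {ι : Type*} (b : Module.Basis ι F g)

/-- The generators `a_i`, `ψ(u_k)` of the W-algebra. -/
def wGen : I ⊕ K → DiffPoly F ι :=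
  Sum.elim (fun i => emb b (c i : g))
    (fun k => psi b e f (fun k => (u k : g)) (fun k => (ud k : g)) (u k : g))

/-- The generators `a_i`, `ψ(u_k)`, `[e, u_k]` of `V(g_{≤ 1/2})`. -/
def adaptedGen : (I ⊕ K) ⊕ K → DiffPoly F ι :=
  Sum.elim (wGen (e := e) c u ud b) (fun k => emb b ⁅e, (u k : g)⁆)

/-- The coordinates of the component in `g_0` with respect to the `a_i` and `[e, u_k]`. -/
def coordZero : g →ₗ[F] DiffPoly F ((I ⊕ K) ⊕ K) :=
  c.constr F (fun i => MvPolynomial.X (Sum.inl (Sum.inl i), 0)) ∘ₗ T.centComp +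
    u.constr F (fun k => MvPolynomial.X (Sum.inr k, 0)) ∘ₗ T.lieComp

/-- The expression of `u_k` through the adapted generators. -/
def coordNeg (k : K) : DiffPoly F ((I ⊕ K) ⊕ K) :=
  MvPolynomial.X (Sum.inl (Sum.inr k), 0)
    + (1 / 2 : F) • ∑ l, coordZero T c u ⁅(u k : g), (ud l : g)⁆ * coordZero T c u ⁅e, (u l : g)⁆
    + (1 / 8 : F) • ∑ l, coordZero T c u ⁅f, (ud l : g)⁆ *
        coordZero T c u ⁅e, jordan e (u k : g) (u l : g)⁆
    - (1 / 2 : F) • del (coordZero T c u ⁅e, (u k : g)⁆)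

/-- The expression of the elements of `g_{≤ 1/2}` through the adapted generators. -/
def coord : g →ₗ[F] DiffPoly F ((I ⊕ K) ⊕ K) :=
  coordZero T c u + u.constr F (coordNeg T c u ud) ∘ₗ T.negComp

/-- The expression of differential polynomials through the adapted generators. -/
def toAdapted : DiffPoly F ι →ₐ[F] DiffPoly F ((I ⊕ K) ⊕ K) :=
  diffHom fun i => coord T c u ud (b i)

lemma coord_of_mem_zero {q : g} (hq : q ∈ gr F x 0) : coord T c u ud q = coordZero T c u q := by
  simp [coord, T.negComp_of_mem_zero hq]

omit [Fintype K] in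
lemma coordZero_basis (i : I) :
    coordZero T c u (c i : g) = MvPolynomial.X (Sum.inl (Sum.inl i), 0) := by
  simp [coordZero, T.centComp_coe, T.lieComp_coe]

omit [Fintype K] in
lemma coordZero_lie_e (k : K) :
    coordZero T c u ⁅e, (u k : g)⁆ = MvPolynomial.X (Sum.inr k, 0) := by
  simp [coordZero, T.centComp_lie_e, T.lieComp_lie_e]

lemma coord_neg (k : K) : coord T c u ud (u k : g) = coordNeg T c u ud k := by
  simp [coord, coordZero, T.centComp_of_mem_neg (u k).2, T.lieComp_of_mem_neg (u k).2,
    T.negComp_coe, -Module.Basis.constr_apply_fintype, Module.Basis.constr_basis]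

lemma toAdapted_emb (y : g) : toAdapted T c u ud b (emb b y) = coord T c u ud y :=
  diffHom_emb b (coord T c u ud) y

lemma toAdapted_emb_zero {q : g} (hq : q ∈ gr F x 0) :
    toAdapted T c u ud b (emb b q) = coordZero T c u q := by
  rw [toAdapted_emb, coord_of_mem_zero T c u ud hq]

lemma toAdapted_del (p : DiffPoly F ι) :
    toAdapted T c u ud b (del p) = del (toAdapted T c u ud b p) :=
  diffHom_del _ p

/-- Apart from `u_k`, the terms of `ψ(u_k)` involve only `g_0`, whose coordinates are linear.
Solving for `u_k` therefore needs no recursion, and `coordNeg` undoes `ψ` term by term. -/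
lemma toAdapted_adaptedGen (j : (I ⊕ K) ⊕ K) :
    toAdapted T c u ud b (adaptedGen (e := e) c u ud b j) = MvPolynomial.X (j, 0) := by
  rcases j with (i | k) | k
  · exact (toAdapted_emb_zero T c u ud b (c i).2.1).trans (coordZero_basis T c u i)
  · change toAdapted T c u ud b (_ - _ - _ + _) = _
    rw [map_add, map_sub, map_sub, map_smul, map_smul, map_smul, map_sum, map_sum, toAdapted_del,
      toAdapted_emb, coord_neg, toAdapted_emb_zero T c u ud b (T.lie_e_mem (u k).2)]
    have h1 (l : K) : toAdapted T c u ud b (emb b ⁅(u k : g), (ud l : g)⁆ * emb b ⁅e, (u l : g)⁆) =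
        coordZero T c u ⁅(u k : g), (ud l : g)⁆ * coordZero T c u ⁅e, (u l : g)⁆ := by
      rw [map_mul, toAdapted_emb_zero T c u ud b (lie_mem_gr (by norm_num) (u k).2 (ud l).2),
        toAdapted_emb_zero T c u ud b (T.lie_e_mem (u l).2)]
    have h2 (l : K) : toAdapted T c u ud b
          (emb b ⁅f, (ud l : g)⁆ * emb b ⁅e, jordan e (u k : g) (u l : g)⁆) =
        coordZero T c u ⁅f, (ud l : g)⁆ * coordZero T c u ⁅e, jordan e (u k : g) (u l : g)⁆ := by
      rw [map_mul, toAdapted_emb_zero T c u ud b (T.lie_f_mem (ud l).2),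
        toAdapted_emb_zero T c u ud b (T.lie_e_mem (T.jordan_mem (u k).2 (u l).2))]
    simp only [h1, h2, coordNeg]
    module
  · exact (toAdapted_emb_zero T c u ud b (T.lie_e_mem (u k).2)).trans (coordZero_lie_e T c u k)

lemma toAdapted_diffHom (P : DiffPoly F ((I ⊕ K) ⊕ K)) :
    toAdapted T c u ud b (diffHom (adaptedGen (e := e) c u ud b) P) = P := by
  have h : (toAdapted T c u ud b).comp (diffHom (adaptedGen (e := e) c u ud b)) = AlgHom.id F _ := by
    refine MvPolynomial.algHom_ext fun p => ?_
    rw [AlgHom.comp_apply, diffHom_X, toAdapted, diffHom_del_iterate, ← toAdapted,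
      toAdapted_adaptedGen, del_iterate_X]
    rfl
  exact AlgHom.congr_fun h P

lemma diffHom_coordZero {q : g} (hq : q ∈ gr F x 0) :
    diffHom (adaptedGen (e := e) c u ud b) (coordZero T c u q) = emb b q := by
  have h1 : (diffHom (adaptedGen (e := e) c u ud b)).toLinearMap ∘ₗ
      c.constr F (fun i => MvPolynomial.X (Sum.inl (Sum.inl i), 0)) =
      emb b ∘ₗ (gr0Cent F x f).subtype :=
    c.ext fun i => by simp [diffHom_X, adaptedGen, wGen]
  have h2 : (diffHom (adaptedGen (e := e) c u ud b)).toLinearMap ∘ₗ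
      u.constr F (fun k => MvPolynomial.X (Sum.inr k, 0)) =
      emb b ∘ₗ (LieAlgebra.ad F g e : g →ₗ[F] g) ∘ₗ (gr F x (-1)).subtype :=
    u.ext fun i => by
      simp [diffHom_X, adaptedGen, -Module.Basis.constr_apply_fintype, Module.Basis.constr_basis]
  rw [coordZero, LinearMap.add_apply, map_add]
  refine (congrArg₂ (· + ·) (LinearMap.congr_fun h1 (T.centComp q))
    (LinearMap.congr_fun h2 (T.lieComp q))).trans ?_
  conv_rhs => rw [← T.centComp_add hq, map_add]
  rfl

lemma diffHom_coord_neg {v : g} (hv : v ∈ gr F x (-1)) :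
    diffHom (adaptedGen (e := e) c u ud b) (coord T c u ud v) = emb b v := by
  have h : (diffHom (adaptedGen (e := e) c u ud b)).toLinearMap ∘ₗ
      coord T c u ud ∘ₗ (gr F x (-1)).subtype = emb b ∘ₗ (gr F x (-1)).subtype := by
    refine u.ext fun k => ?_
    change diffHom (adaptedGen (e := e) c u ud b) (coord T c u ud (u k : g)) = emb b (u k : g)
    have h1 (l : K) := diffHom_coordZero T c u ud b
      (lie_mem_gr (k := 0) (by norm_num) (u k).2 (ud l).2)
    have h2 (l : K) := diffHom_coordZero T c u ud b (T.lie_e_mem (u l).2)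
    have h3 (l : K) := diffHom_coordZero T c u ud b (T.lie_f_mem (ud l).2)
    have h4 (l : K) := diffHom_coordZero T c u ud b
      (T.lie_e_mem (T.jordan_mem (u k).2 (u l).2))
    have h5 : diffHom (adaptedGen (e := e) c u ud b)
        (MvPolynomial.X (Sum.inl (Sum.inr k), 0)) =
        psi b e f (fun k => (u k : g)) (fun k => (ud k : g)) (u k : g) := diffHom_X _ _
    rw [coord_neg, coordNeg, map_sub, map_add, map_add, map_smul, map_smul, map_smul, map_sum,
      map_sum, diffHom_del, h2, h5]
    simp only [map_mul, h1, h2, h3, h4]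
    change (_ - _ - _ + _ : DiffPoly F ι) + _ + _ - _ = _
    module
  exact LinearMap.congr_fun h ⟨v, hv⟩

/-- The restriction to `V(g_{≤1/2})` is essential, since `toAdapted` kills `g_1`. -/
lemma diffHom_toAdapted {p : DiffPoly F ι} (hp : p ∈ subLE b x) :
    diffHom (adaptedGen (e := e) c u ud b) (toAdapted T c u ud b p) = p := by
  have h : subLE b x ≤ AlgHom.equalizer ((diffHom (adaptedGen (e := e) c u ud b)).comp
      (toAdapted T c u ud b)) (AlgHom.id F _) := by
    refine Algebra.adjoin_le ?_
    rintro _ ⟨y, hy, n, rfl⟩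
    rw [T.short.grLE_half] at hy
    obtain ⟨v, hv, q, hq, rfl⟩ := Submodule.mem_sup.mp hy
    change diffHom _ (toAdapted T c u ud b _) = del^[n] _
    rw [toAdapted, diffHom_del_iterate, diffHom_del_iterate, ← toAdapted, toAdapted_emb, map_add,
      map_add, map_add, coord_of_mem_zero T c u ud hq, diffHom_coordZero T c u ud b hq,
      diffHom_coord_neg T c u ud b hv]
  exact h hp

include T in
lemma adaptedGen_mem_subLE (j : (I ⊕ K) ⊕ K) :
    adaptedGen (e := e) c u ud b j ∈ subLE b x := by
  rcases j with (i | k) | k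
  · exact T.mem_subLE_of_zero b (c i).2.1
  · exact psi_mem_subLE T u ud b (u k).2
  · exact T.mem_subLE_of_zero b (T.lie_e_mem (u k).2)

include T in
lemma diffHom_mem_subLE (P : DiffPoly F ((I ⊕ K) ⊕ K)) :
    diffHom (adaptedGen (e := e) c u ud b) P ∈ subLE b x := by
  induction P using MvPolynomial.induction_on with
  | C r => rw [← MvPolynomial.algebraMap_eq, AlgHom.commutes]; exact Subalgebra.algebraMap_mem _ r
  | add p q hp hq => rw [map_add]; exact add_mem hp hq
  | mul_X p i hp =>
    rw [map_mul, diffHom_X]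
    exact mul_mem hp (del_iterate_mem_subLE b (adaptedGen_mem_subLE T c u ud b i.1) _)

include T in
lemma diffHom_adaptedGen_injective : Function.Injective
    (diffHom (adaptedGen (e := e) c u ud b) : DiffPoly F ((I ⊕ K) ⊕ K) →+* DiffPoly F ι) :=
  Function.LeftInverse.injective (g := toAdapted T c u ud b) (toAdapted_diffHom T c u ud b)

include T in
lemma algebraicIndependent_wGen :
    AlgebraicIndependent F fun p : (I ⊕ K) × ℕ => del^[p.2] (wGen (e := e) c u ud b p.1) := by
  have h : AlgebraicIndependent F
      fun p : ((I ⊕ K) ⊕ K) × ℕ => del^[p.2] (adaptedGen (e := e) c u ud b p.1) :=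
    -- Algebraic independence is by definition injectivity of the evaluation map, which here is
    -- `diffHom`.
    diffHom_adaptedGen_injective T c u ud b
  exact h.comp (fun p : (I ⊕ K) × ℕ => (Sum.inl p.1, p.2)) fun p q hpq => by
    simpa [Prod.ext_iff] using hpq

/-! ### The invariants -/

variable {s : g} (z : F)

lemma emb_mem_wSubalgebra (hs : s ∈ gr F x 1) {q : g} (hq : q ∈ gr0Cent F x f) :
    emb b q ∈ wSubalgebra b κ f s z T.short := by
  rw [mem_wSubalgebra_iff]
  refine ⟨T.mem_subLE_of_zero b hq.1, fun a ha => ?_⟩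
  have h0 : κ f ⁅a, q⁆ = 0 := by
    rw [← T.inv, ← lie_skew, map_neg, LinearMap.neg_apply, T.inv, show ⁅f, q⁆ = 0 from hq.2,
      map_zero, neg_zero]
  rw [T.redBracket_emb_zero b z hs ha hq.1, h0, map_zero, map_zero]

variable [DecidableEq K] (hdual : ∀ k l, κ (u k) (ud l) = if k = l then 1 else 0)

include hdual in
lemma wGen_mem_wSubalgebra (hs : s ∈ gr F x 1) (j : I ⊕ K) :
    wGen (e := e) c u ud b j ∈ wSubalgebra b κ f s z T.short := by
  rcases j with i | k
  · exact emb_mem_wSubalgebra T b z hs (c i).2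
  · exact psi_mem_wSubalgebra T u ud hdual b z hs (u k).2

include T hdual in
-- Both sides obey the same Leibniz rule, so only variables matter. The `a_i` and `ψ(u_k)` are
-- invariant with all their derivatives, while `[e, u_k]` has a scalar bracket, on which `(λ + ∂)^n`
-- acts as `λ^n`.
lemma redBracket_diffHom (hs : s ∈ gr F x 1) {a : g} (ha : a ∈ gr F x 1)
    (P : DiffPoly F ((I ⊕ K) ⊕ K)) :
    redBracket b κ x f s z a (diffHom (adaptedGen (e := e) c u ud b) P) =
      (MvPolynomial.mkDerivation F (fun p : ((I ⊕ K) ⊕ K) × ℕ =>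
        (Sum.elim (fun _ => 0) (fun k => C (MvPolynomial.C (-2 * κ a (u k))) * X ^ p.2) p.1 :
          (DiffPoly F ((I ⊕ K) ⊕ K))[X])) P).map
        (diffHom (adaptedGen (e := e) c u ud b) : _ →+* DiffPoly F ι) := by
  induction P using MvPolynomial.induction_on with
  | C r =>
    rw [MvPolynomial.derivation_C, Polynomial.map_zero, ← MvPolynomial.algebraMap_eq,
      AlgHom.commutes, redBracket_algebraMap]
  | add p q hp hq => rw [map_add, map_add, map_add, Polynomial.map_add, hp, hq]
  | mul_X p i hp =>
    have hX : redBracket b κ x f s z a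
        (diffHom (adaptedGen (e := e) c u ud b) (MvPolynomial.X i)) =
        (Sum.elim (fun _ => 0) (fun k => C (MvPolynomial.C (-2 * κ a (u k))) * X ^ i.2) i.1 :
          (DiffPoly F ((I ⊕ K) ⊕ K))[X]).map
          (diffHom (adaptedGen (e := e) c u ud b) : _ →+* DiffPoly F ι) := by
      obtain ⟨j | k, n⟩ := i
      · rw [diffHom_X]
        have h := del_iterate_mem_wSubalgebra b z T.short
          (wGen_mem_wSubalgebra T c u ud b z hdual hs j) n
        rw [mem_wSubalgebra_iff] at h
        exact (h.2 a ha).trans (Polynomial.map_zero _).symm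
      · rw [diffHom_X, redBracket_del_iterate]
        refine (congrArg (lamDel^[n]) (T.redBracket_emb_zero b z hs ha
          (T.lie_e_mem (u k).2))).trans ?_
        rw [lamDel_iterate_C, T.form_f_lie_lie_e (u k).2]
        have hC (r : F) : diffHom (adaptedGen (e := e) c u ud b) (MvPolynomial.C r) =
          MvPolynomial.C r := AlgHom.commutes _ r
        simp only [Sum.elim_inr, Polynomial.map_mul, Polynomial.map_C, Polynomial.map_pow,
          Polynomial.map_X, RingHom.coe_coe, hC]
    rw [map_mul, redBracket_mul, hX, hp, rho_of_mem_subLE b T (diffHom_mem_subLE T c u ud b _),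
      rho_of_mem_subLE b T (diffHom_mem_subLE T c u ud b _), Derivation.leibniz,
      MvPolynomial.mkDerivation_X, Polynomial.smul_eq_C_mul, Polynomial.smul_eq_C_mul,
      Polynomial.map_add, Polynomial.map_mul, Polynomial.map_mul, Polynomial.map_C,
      Polynomial.map_C]
    rfl

include T hdual in
-- Bracketing with `u^k` isolates the index `k`, and the coefficient of `λ^n` isolates the order of
-- derivation. What remains is `-2 ∂P/∂[e, u_k]^{(n)} = 0`.
lemma notMem_vars_of_redBracket_eq_zero (hs : s ∈ gr F x 1)
    {P : DiffPoly F ((I ⊕ K) ⊕ K)} {k : K}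
    (hP : redBracket b κ x f s z (ud k) (diffHom (adaptedGen (e := e) c u ud b) P) = 0) (n : ℕ) :
    (Sum.inr k, n) ∉ P.vars := by
  classical
  intro hj
  refine absurd hj (notMem_vars_of_pderiv_eq_zero ?_)
  rw [redBracket_diffHom T c u ud b z hdual hs (ud k).2, Polynomial.map_eq_zero_iff
    (diffHom_adaptedGen_injective T c u ud b), ← sum_pderiv_eq_mkDerivation] at hP
  have h1 := congrArg (fun Q => Q.coeff n) hP
  simp only [Polynomial.finsetSum_coeff, Polynomial.coeff_C_mul, Polynomial.coeff_zero] at h1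
  have hk (k' : K) : κ (ud k) (u k') = if k' = k then 1 else 0 := by rw [T.symm, hdual]
  rw [Finset.sum_eq_single_of_mem _ hj] at h1
  · rw [Sum.elim_inr, hk, if_pos rfl, Polynomial.coeff_C_mul, Polynomial.coeff_X_pow_self,
      mul_one, mul_one] at h1
    refine (mul_eq_zero.mp h1).resolve_right ?_
    exact (map_ne_zero_iff _ (MvPolynomial.C_injective _ F)).mpr (neg_ne_zero.mpr two_ne_zero)
  · rintro ⟨j' | k', n'⟩ _ hne
    · rw [Sum.elim_inl, Polynomial.coeff_zero, mul_zero]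
    · rw [Sum.elim_inr, hk, Polynomial.coeff_C_mul, Polynomial.coeff_X_pow]
      by_cases hkk : k' = k
      · have hn : n ≠ n' := by rintro rfl; exact hne (by rw [hkk])
        rw [if_neg hn, mul_zero, mul_zero]
      · rw [if_neg hkk, mul_zero, map_zero, zero_mul, mul_zero]

include hdual in
lemma toAdapted_mem_supported (hs : s ∈ gr F x 1) {p : DiffPoly F ι}
    (hp : p ∈ wSubalgebra b κ f s z T.short) :
    toAdapted T c u ud b p ∈
      MvPolynomial.supported F (Set.range fun p : (I ⊕ K) × ℕ => (Sum.inl (β := K) p.1, p.2)) := by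
  rw [mem_wSubalgebra_iff] at hp
  rw [MvPolynomial.mem_supported]
  rintro ⟨j | k, n⟩ hj
  · exact ⟨(j, n), rfl⟩
  · refine absurd hj (notMem_vars_of_redBracket_eq_zero T c u ud b z hdual hs ?_ n)
    rw [diffHom_toAdapted T c u ud b hp.1]
    exact hp.2 _ (ud k).2

include hdual in
-- An invariant, written in adapted coordinates, uses only the variables of the `a_i` and `ψ(u_k)`;
-- `diffHom` carries those variables to the stated generators.
lemma wSubalgebra_eq_adjoin (hs : s ∈ gr F x 1) : wSubalgebra b κ f s z T.short =
    Algebra.adjoin F (Set.range fun p : (I ⊕ K) × ℕ => del^[p.2] (wGen (e := e) c u ud b p.1)) := by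
  refine le_antisymm (fun p hp => ?_) (Algebra.adjoin_le ?_)
  · have h := toAdapted_mem_supported T c u ud b z hdual hs hp
    rw [MvPolynomial.supported_eq_adjoin_X] at h
    have h' := Subalgebra.mem_map.mpr
      ⟨_, h, diffHom_toAdapted T c u ud b ((mem_wSubalgebra_iff b z T.short).mp hp).1⟩
    rw [AlgHom.map_adjoin] at h'
    refine Algebra.adjoin_mono ?_ h'
    rintro _ ⟨_, ⟨_, ⟨q, rfl⟩, rfl⟩, rfl⟩
    exact ⟨q, (diffHom_X (adaptedGen (e := e) c u ud b) (Sum.inl q.1, q.2)).symm⟩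
  · rintro _ ⟨q, rfl⟩
    exact del_iterate_mem_wSubalgebra b z T.short
      (wGen_mem_wSubalgebra T c u ud b z hdual hs q.1) q.2

end Coordinates

/-! ### Linear terms of differential polynomials -/

section LinearTerms

variable {F : Type*} [Field F] {ι : Type*}

/-- The coefficient of the variable `u_i^{(n)}`, `j = (i, n)`. -/
def linCoeff (j : ι × ℕ) : DiffPoly F ι →ₗ[F] F :=
  (MvPolynomial.aeval (0 : ι × ℕ → F)).toLinearMap ∘ₗ (MvPolynomial.pderiv j).toLinearMap

lemma linCoeff_X [DecidableEq ι] (j p : ι × ℕ) :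
    linCoeff (F := F) j (MvPolynomial.X p) = if p = j then 1 else 0 := by
  have : linCoeff (F := F) j (MvPolynomial.X p) =
    MvPolynomial.aeval (0 : ι × ℕ → F) (MvPolynomial.pderiv j (MvPolynomial.X p)) := rfl
  rw [this, MvPolynomial.pderiv_X, Pi.single_apply]
  simp only [apply_ite (MvPolynomial.aeval (0 : ι × ℕ → F)), map_one, map_zero, eq_comm]

variable {g : Type*} [LieRing g] [LieAlgebra F g] (b : Module.Basis ι F g)

lemma aeval_zero_emb (y : g) : MvPolynomial.aeval (0 : ι × ℕ → F) (emb b y) = 0 := by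
  have h : (MvPolynomial.aeval (0 : ι × ℕ → F)).toLinearMap ∘ₗ emb b = 0 :=
    b.ext fun i => by simp [emb_basis]
  exact LinearMap.congr_fun h y

lemma linCoeff_emb_mul_emb (j : ι × ℕ) (y y' : g) : linCoeff j (emb b y * emb b y') = 0 := by
  change MvPolynomial.aeval (0 : ι × ℕ → F) (MvPolynomial.pderiv j (emb b y * emb b y')) = 0
  rw [Derivation.leibniz, map_add, smul_eq_mul, smul_eq_mul, map_mul, map_mul, aeval_zero_emb,
    aeval_zero_emb, zero_mul, zero_mul, add_zero]

lemma linCoeff_of_mem_sq {S : Submodule F g} (j : ι × ℕ) {Q : DiffPoly F ι}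
    (hQ : Q ∈ (S.map (emb b)) ^ 2) : linCoeff j Q = 0 := by
  rw [pow_two] at hQ
  refine Submodule.mul_induction_on hQ ?_ fun p q hp hq => by rw [map_add, hp, hq, add_zero]
  rintro _ ⟨y, -, rfl⟩ _ ⟨y', -, rfl⟩
  exact linCoeff_emb_mul_emb b j y y'

lemma linCoeff_emb_zero (i : ι) (y : g) : linCoeff (i, 0) (emb b y) = b.repr y i := by
  classical
  have h : linCoeff (i, 0) ∘ₗ emb b = Finsupp.lapply i ∘ₗ b.repr.toLinearMap :=
    b.ext fun j => by simp [emb_basis, linCoeff_X, Finsupp.single_apply]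
  exact LinearMap.congr_fun h y

lemma linCoeff_del_emb_zero (i : ι) (y : g) : linCoeff (i, 0) (del (emb b y)) = 0 := by
  classical
  have h : linCoeff (F := F) (i, 0) ∘ₗ (del : Derivation F _ _).toLinearMap ∘ₗ emb b = 0 :=
    b.ext fun j => by simp [emb_basis, linCoeff_X, del_X]
  exact LinearMap.congr_fun h y

lemma linCoeff_del_emb_one (i : ι) (y : g) : linCoeff (i, 1) (del (emb b y)) = b.repr y i := by
  classical
  have h : linCoeff (F := F) (i, 1) ∘ₗ (del : Derivation F _ _).toLinearMap ∘ₗ emb b =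
      Finsupp.lapply i ∘ₗ b.repr.toLinearMap :=
    b.ext fun j => by simp [emb_basis, linCoeff_X, del_X, Finsupp.single_apply]
  exact LinearMap.congr_fun h y

end LinearTerms

/-! ### Conformal weights -/

section Weight

variable {F : Type*} [Field F] [CharZero F] {g : Type*} [LieRing g] [LieAlgebra F g]
  {ι : Type*} (b : Module.Basis ι F g) {x : g}

omit [CharZero F] in
lemma del_emb_mem_weightSpace {y : g} {δ Δ : ℚ} (hδ : 1 / 2 ≤ δ) (hy : y ∈ gr F x (1 - δ)) (m : ℕ)
    (hΔ : δ + m = Δ) : del^[m] (emb b y) ∈ weightSpace b x Δ :=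
  Submodule.subset_span ⟨1, fun _ => y, fun _ => δ, fun _ => m, fun _ => ⟨hδ, hy⟩, by simpa,
    by simp⟩

omit [CharZero F] in
lemma emb_mul_emb_mem_weightSpace {q q' : g} (hq : q ∈ gr F x 0) (hq' : q' ∈ gr F x 0) :
    emb b q * emb b q' ∈ weightSpace b x 2 := by
  refine Submodule.subset_span ⟨2, ![q, q'], fun _ => 1, fun _ => 0, ?_, by norm_num, ?_⟩
  · intro i
    fin_cases i
    · exact ⟨by norm_num, by simpa using hq⟩
    · exact ⟨by norm_num, by simpa using hq'⟩
  · simp [Fin.prod_univ_two]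

omit [CharZero F] in
lemma emb_mem_weightSpace_one {q : g} (hq : q ∈ gr F x 0) : emb b q ∈ weightSpace b x 1 :=
  del_emb_mem_weightSpace b (δ := 1) (by norm_num) (by simpa using hq) 0 (by norm_num)

omit [CharZero F] in
lemma del_emb_mem_weightSpace_two {q : g} (hq : q ∈ gr F x 0) :
    del (emb b q) ∈ weightSpace b x 2 :=
  del_emb_mem_weightSpace b (δ := 1) (by norm_num) (by simpa using hq) 1 (by norm_num)

omit [CharZero F] in
lemma emb_mem_weightSpace_two {v : g} (hv : v ∈ gr F x (-1)) : emb b v ∈ weightSpace b x 2 :=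
  del_emb_mem_weightSpace b (δ := 2) (by norm_num)
    (by rwa [show (1 - 2 : ℚ) = -1 by norm_num]) 0 (by norm_num)

omit [CharZero F] in
lemma sq_le_weightSpace_two : ((gr F x 0).map (emb b)) ^ 2 ≤ weightSpace b x 2 := by
  rw [pow_two, Submodule.mul_le]
  rintro _ ⟨q, hq, rfl⟩ _ ⟨q', hq', rfl⟩
  exact emb_mul_emb_mem_weightSpace b hq hq'

lemma IsShort.weight_eq (h : IsShort F x) {y : g} {δ : ℚ} (hδ : 1 / 2 ≤ δ)
    (hy : y ∈ gr F x (1 - δ)) (h0 : y ≠ 0) : δ = 1 ∨ δ = 2 := by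
  by_contra hne
  rw [not_or] at hne
  rw [h.gr_eq_bot (fun h => hne.2 (by linarith)) (fun h => hne.1 (by linarith))
    (fun h => by linarith), Submodule.mem_bot] at hy
  exact h0 hy

/-- To bound a weight space it suffices to consider products of nonzero elements, whose number is at
most the weight. -/
lemma IsShort.weightSpace_le (h : IsShort F x) {Δ : ℚ} {S : Submodule F (DiffPoly F ι)}
    (hS : ∀ (r : ℕ) (a : Fin r → g) (δ : Fin r → ℚ) (m : Fin r → ℕ), (r : ℚ) ≤ Δ →
      (∀ i, (δ i = 1 ∨ δ i = 2) ∧ a i ∈ gr F x (1 - δ i)) → ∑ i, (δ i + (m i : ℚ)) = Δ →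
      ∏ i, del^[m i] (emb b (a i)) ∈ S) : weightSpace b x Δ ≤ S := by
  refine Submodule.span_le.mpr ?_
  rintro _ ⟨r, a, δ, m, ha, hΔ, rfl⟩
  -- A zero factor lies in every eigenspace, so its `δ i` is unconstrained; nonzero factors have `δ
  -- i` equal to `1` or `2`.
  by_cases h0 : ∃ i, a i = 0
  · obtain ⟨i, hi⟩ := h0
    rw [Finset.prod_eq_zero (Finset.mem_univ i)
      (by rw [hi, map_zero, del_iterate_zero])]
    exact zero_mem _
  · rw [not_exists] at h0
    have hδ := fun i => h.weight_eq (ha i).1 (ha i).2 (h0 i)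
    refine hS r a δ m ?_ (fun i => ⟨hδ i, (ha i).2⟩) hΔ
    have hr : ∑ _i : Fin r, (1 : ℚ) ≤ ∑ i, (δ i + (m i : ℚ)) := by
      refine Finset.sum_le_sum fun i _ => ?_
      have hm : (0 : ℚ) ≤ m i := Nat.cast_nonneg _
      rcases hδ i with h1 | h1 <;> linarith
    rw [hΔ] at hr
    simpa using hr

lemma IsShort.weightSpace_one_le (h : IsShort F x) :
    weightSpace b x 1 ≤ (gr F x 0).map (emb b) := by
  refine h.weightSpace_le b fun r a δ m hr ha hΔ => ?_
  have hr' : r ≤ 1 := by exact_mod_cast hr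
  interval_cases r
  · simp at hΔ
  · have hm : (0 : ℚ) ≤ m 0 := Nat.cast_nonneg _
    simp only [Fin.sum_univ_one] at hΔ
    have hδ : δ 0 = 1 := (ha 0).1.resolve_right fun h2 => by linarith
    have hm0 : m 0 = 0 := by
      have : (m 0 : ℚ) = 0 := by linarith
      exact_mod_cast this
    have ha0 := (ha 0).2
    rw [hδ, sub_self] at ha0
    rw [Fin.prod_univ_one, hm0]
    exact ⟨_, ha0, rfl⟩

/-- Each factor has weight at least one. So either there is one factor, from `g_{-1}` underived or
from `g_0` derived once, or there are two underived factors from `g_0`. -/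
lemma IsShort.weightSpace_two_le (h : IsShort F x) :
    weightSpace b x 2 ≤ (gr F x (-1)).map (emb b) ⊔
      ((gr F x 0).map (emb b)).map (del : Derivation F _ _).toLinearMap ⊔
      ((gr F x 0).map (emb b)) ^ 2 := by
  refine h.weightSpace_le b fun r a δ m hr ha hΔ => ?_
  have hr' : r ≤ 2 := by exact_mod_cast hr
  interval_cases r
  · simp at hΔ
  · simp only [Fin.sum_univ_one] at hΔ
    have ha0 := (ha 0).2
    rw [Fin.prod_univ_one]
    rcases (ha 0).1 with hδ | hδ
    · have hm0 : m 0 = 1 := by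
        have : (m 0 : ℚ) = 1 := by linarith
        exact_mod_cast this
      rw [hδ, sub_self] at ha0
      rw [hm0]
      exact Submodule.mem_sup_left (Submodule.mem_sup_right ⟨_, ⟨_, ha0, rfl⟩, rfl⟩)
    · have hm0 : m 0 = 0 := by
        have : (m 0 : ℚ) = 0 := by linarith
        exact_mod_cast this
      rw [hδ, show (1 - 2 : ℚ) = -1 by norm_num] at ha0
      rw [hm0]
      exact Submodule.mem_sup_left (Submodule.mem_sup_left ⟨_, ha0, rfl⟩)
  · simp only [Fin.sum_univ_two] at hΔ
    have h0 : (0 : ℚ) ≤ m 0 := Nat.cast_nonneg _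
    have h1 : (0 : ℚ) ≤ m 1 := Nat.cast_nonneg _
    have hδ0 : 1 ≤ δ 0 := by rcases (ha 0).1 with h | h <;> linarith
    have hδ1 : 1 ≤ δ 1 := by rcases (ha 1).1 with h | h <;> linarith
    have hm0 : m 0 = 0 := by
      have : (m 0 : ℚ) = 0 := by linarith
      exact_mod_cast this
    have hm1 : m 1 = 0 := by
      have : (m 1 : ℚ) = 0 := by linarith
      exact_mod_cast this
    have ha0 := (ha 0).2
    have ha1 := (ha 1).2
    rw [show δ 0 = 1 by linarith, sub_self] at ha0
    rw [show δ 1 = 1 by linarith, sub_self] at ha1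
    rw [Fin.prod_univ_two, hm0, hm1]
    refine Submodule.mem_sup_right ?_
    rw [pow_two]
    exact Submodule.mul_mem_mul ⟨_, ha0, rfl⟩ ⟨_, ha1, rfl⟩

end Weight

/-! ### The low weight spaces of the W-algebra -/

section LowWeight

variable {F : Type*} [Field F] [CharZero F] {g : Type*} [LieRing g] [LieAlgebra F g]
  {κ : LinearMap.BilinForm F g} {e x f : g} (T : ShortTriple κ e x f)
  {I : Type*} (c : Module.Basis I F (gr0Cent F x f))
  {K : Type*} [Fintype K]
  (u : Module.Basis K F (gr F x (-1))) (ud : Module.Basis K F (gr F x 1))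
  {ι : Type*} (b : Module.Basis ι F g)

include T in
lemma exists_psi_eq {v : g} (hv : v ∈ gr F x (-1)) : ∃ Q ∈ ((gr F x 0).map (emb b)) ^ 2,
    psi b e f (fun k => (u k : g)) (fun k => (ud k : g)) v =
      emb b v + del (emb b ((1 / 2 : F) • ⁅e, v⁆)) + Q := by
  have hmul {q q' : g} (hq : q ∈ gr F x 0) (hq' : q' ∈ gr F x 0) :
      emb b q * emb b q' ∈ ((gr F x 0).map (emb b)) ^ 2 := by
    rw [pow_two]
    exact Submodule.mul_mem_mul ⟨_, hq, rfl⟩ ⟨_, hq', rfl⟩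
  refine ⟨-((1 / 2 : F) • ∑ k, emb b ⁅v, (ud k : g)⁆ * emb b ⁅e, (u k : g)⁆) -
    (1 / 8 : F) • ∑ k, emb b ⁅f, (ud k : g)⁆ * emb b ⁅e, jordan e v (u k : g)⁆, ?_, ?_⟩
  · refine sub_mem (neg_mem (Submodule.smul_mem _ _ (sum_mem fun k _ => hmul ?_ ?_)))
      (Submodule.smul_mem _ _ (sum_mem fun k _ => hmul ?_ ?_))
    · exact lie_mem_gr (by norm_num) hv (ud k).2
    · exact T.lie_e_mem (u k).2
    · exact T.lie_f_mem (ud k).2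
    · exact T.lie_e_mem (T.jordan_mem hv (u k).2)
  · rw [map_smul, Derivation.map_smul]
    change (_ - _ - _ + _ : DiffPoly F ι) = _
    module

include T in
lemma psi_mem_weightSpace {v : g} (hv : v ∈ gr F x (-1)) :
    psi b e f (fun k => (u k : g)) (fun k => (ud k : g)) v ∈ weightSpace b x 2 := by
  obtain ⟨Q, hQ, h⟩ := exists_psi_eq T u ud b hv
  rw [h]
  exact add_mem (add_mem (emb_mem_weightSpace_two b hv)
    (del_emb_mem_weightSpace_two b (Submodule.smul_mem _ _ (T.lie_e_mem hv))))
    (sq_le_weightSpace_two b hQ)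

include T in
-- Only `v` has linear terms of order zero: `∂[e, v]` has order one and the rest is quadratic.
lemma linCoeff_psi {v : g} (hv : v ∈ gr F x (-1)) (i : ι) :
    linCoeff (i, 0) (psi b e f (fun k => (u k : g)) (fun k => (ud k : g)) v) = b.repr v i := by
  obtain ⟨Q, hQ, h⟩ := exists_psi_eq T u ud b hv
  rw [h, map_add, map_add, linCoeff_emb_zero, linCoeff_del_emb_zero, linCoeff_of_mem_sq b _ hQ,
    add_zero, add_zero]

include T in
lemma psi_injOn : Set.InjOn (psi b e f (fun k => (u k : g)) (fun k => (ud k : g)))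
    (gr F x (-1)) := by
  intro v hv w hw h
  refine b.repr.injective (Finsupp.ext fun i => ?_)
  rw [← linCoeff_psi T u ud b hv, ← linCoeff_psi T u ud b hw, h]

include T in
lemma iSupIndep_psi : iSupIndep ![(gr F x (-1)).map
      (psi b e f (fun k => (u k : g)) (fun k => (ud k : g))),
    ((gr0Cent F x f).map (emb b)).map (del : Derivation F _ _).toLinearMap,
    ((gr0Cent F x f).map (emb b)) ^ 2] := by
  -- Linear terms of order zero force `v = 0`. This also removes the contribution `½ ∂[e, v]` of
  -- `ψ(v)`, so the terms of order one then force `q = 0`.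
  have key : ∀ v ∈ gr F x (-1), ∀ q : g, ∀ Q ∈ ((gr0Cent F x f).map (emb b)) ^ 2,
      psi b e f (fun k => (u k : g)) (fun k => (ud k : g)) v + del (emb b q) + Q = 0 →
      v = 0 ∧ q = 0 := by
    intro v hv q Q hQ h
    have hv0 : v = 0 := by
      refine b.repr.injective (Finsupp.ext fun i => ?_)
      have h1 := congrArg (linCoeff (i, 0)) h
      rw [map_add, map_add, linCoeff_psi T u ud b hv, linCoeff_del_emb_zero,
        linCoeff_of_mem_sq b _ hQ, add_zero, add_zero, map_zero] at h1
      rw [h1, map_zero]; rfl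
    refine ⟨hv0, b.repr.injective (Finsupp.ext fun i => ?_)⟩
    have h1 := congrArg (linCoeff (i, 1)) h
    rw [hv0, map_zero, zero_add, map_add, linCoeff_del_emb_one, linCoeff_of_mem_sq b _ hQ,
      add_zero, map_zero] at h1
    rw [h1, map_zero]; rfl
  have hzero : del (emb b (0 : g)) = (0 : DiffPoly F ι) := by rw [map_zero, map_zero]
  rw [iSupIndep_fin_three]
  refine ⟨Submodule.disjoint_def.mpr ?_, Submodule.disjoint_def.mpr ?_,
    Submodule.disjoint_def.mpr ?_⟩
  · rintro _ ⟨v, hv, rfl⟩ h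
    obtain ⟨_, ⟨_, ⟨q, hq, rfl⟩, rfl⟩, Q, hQ, h⟩ := Submodule.mem_sup.mp h
    have hk := key (-v) (neg_mem hv) q Q hQ (by
      rw [map_neg, ← h, Derivation.coeFn_coe]; abel)
    rw [neg_eq_zero.mp hk.1, map_zero]
  · rintro _ ⟨_, ⟨q, hq, rfl⟩, rfl⟩ h
    obtain ⟨Q, hQ, _, ⟨v, hv, rfl⟩, h⟩ := Submodule.mem_sup.mp h
    rw [Derivation.coeFn_coe] at h ⊢
    have hk := key v hv (-q) Q hQ (by
      rw [map_neg, map_neg, ← h]; abel)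
    rw [neg_eq_zero.mp hk.2, hzero]
  · intro Q hQ h
    obtain ⟨_, ⟨v, hv, rfl⟩, _, ⟨_, ⟨q, hq, rfl⟩, rfl⟩, h⟩ := Submodule.mem_sup.mp h
    rw [Derivation.coeFn_coe] at h
    have hk := key v hv q (-Q) (neg_mem hQ) (by rw [← h]; abel)
    rw [← h, hk.1, hk.2, hzero, map_zero, add_zero]

variable {s : g} (z : F)

variable [DecidableEq K] (hdual : ∀ k l, κ (u k) (ud l) = if k = l then 1 else 0)

include T hdual in
lemma wWeight_one (hs : s ∈ gr F x 1) :
    wWeight b κ x f s z 1 = ((gr0Cent F x f).map (emb b) : Submodule F (DiffPoly F ι)) := by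
  ext p
  constructor
  · rintro ⟨hp, hp1⟩
    obtain ⟨q, hq, rfl⟩ := T.short.weightSpace_one_le b hp1
    refine ⟨q, ⟨hq, ?_⟩, rfl⟩
    -- Expand `[f, q]` in the `u_k`: invariance under `u^k` says that the `k`-th coefficient
    -- vanishes.
    have h := sum_form_smul u ud hdual LinearMap.id (T.lie_f_mem_of_zero hq)
    refine h.symm.trans (Finset.sum_eq_zero fun k _ => ?_)
    have h1 := ((mem_wAlgebra_iff b z T.short).mp hp).2 _ (ud k).2
    rw [T.redBracket_emb_zero b z hs (ud k).2 hq, Polynomial.C_eq_zero, MvPolynomial.C_eq_zero,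
      ← lie_skew, map_neg, ← T.inv, neg_eq_zero] at h1
    rw [h1, zero_smul]
  · rintro ⟨q, hq, rfl⟩
    exact ⟨emb_mem_wSubalgebra T b z hs hq, emb_mem_weightSpace_one b hq.1⟩

/-- The retraction of `V(g_{≤ 1/2})` on the W-algebra that kills the generators `[e, u_k]`. -/
def retraction : DiffPoly F ι →ₐ[F] DiffPoly F ι :=
  (diffHom (adaptedGen (e := e) c u ud b)).comp
    ((diffHom (Sum.elim (fun j => MvPolynomial.X (Sum.inl j, 0)) 0)).comp (toAdapted T c u ud b))

omit [DecidableEq K] in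
lemma retraction_del (p : DiffPoly F ι) :
    retraction T c u ud b (del p) = del (retraction T c u ud b p) := by
  simp only [retraction, AlgHom.comp_apply, toAdapted_del, diffHom_del]

omit [DecidableEq K] in
lemma retraction_emb {q : g} (hq : q ∈ gr F x 0) :
    retraction T c u ud b (emb b q) = emb b (T.centComp q : g) := by
  have h1 : (diffHom (F := F) (Sum.elim (fun j => MvPolynomial.X (Sum.inl j, 0))
        (0 : K → DiffPoly F ((I ⊕ K) ⊕ K)))).toLinearMap ∘ₗ
      c.constr F (fun i => MvPolynomial.X (Sum.inl (Sum.inl i), 0)) =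
      coordZero T c u ∘ₗ (gr0Cent F x f).subtype :=
    c.ext fun i => by simp [diffHom_X, coordZero_basis]
  have h2 : (diffHom (F := F) (Sum.elim (fun j => MvPolynomial.X (Sum.inl j, 0))
        (0 : K → DiffPoly F ((I ⊕ K) ⊕ K)))).toLinearMap ∘ₗ
      u.constr F (fun k => MvPolynomial.X (Sum.inr k, 0)) = 0 :=
    u.ext fun i => by
      simp [diffHom_X, -Module.Basis.constr_apply_fintype, Module.Basis.constr_basis]
  have h3 : diffHom (Sum.elim (fun j => MvPolynomial.X (Sum.inl j, 0)) 0) (coordZero T c u q) =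
      coordZero T c u (T.centComp q : g) := by
    conv_lhs => rw [coordZero, LinearMap.add_apply, map_add]
    exact (congrArg₂ (· + ·) (LinearMap.congr_fun h1 (T.centComp q))
      (LinearMap.congr_fun h2 (T.lieComp q))).trans (add_zero _)
  rw [retraction, AlgHom.comp_apply, AlgHom.comp_apply, toAdapted_emb_zero T c u ud b hq, h3,
    diffHom_coordZero T c u ud b (T.centComp q).2.1]

include hdual in
lemma retraction_of_mem (hs : s ∈ gr F x 1) {p : DiffPoly F ι}
    (hp : p ∈ wSubalgebra b κ f s z T.short) : retraction T c u ud b p = p := by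
  have h := toAdapted_mem_supported T c u ud b z hdual hs hp
  have hle : MvPolynomial.supported F
      (Set.range fun p : (I ⊕ K) × ℕ => (Sum.inl (β := K) p.1, p.2)) ≤
      AlgHom.equalizer (diffHom (F := F) (Sum.elim (fun j => MvPolynomial.X (Sum.inl j, 0)) 0))
        (AlgHom.id F _) := by
    rw [MvPolynomial.supported_eq_adjoin_X]
    refine Algebra.adjoin_le ?_
    rintro _ ⟨_, ⟨⟨j, n⟩, rfl⟩, rfl⟩
    exact (diffHom_X _ _).trans (del_iterate_X _ _)
  rw [retraction, AlgHom.comp_apply, AlgHom.comp_apply, show diffHom _ _ = _ from hle h]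
  exact diffHom_toAdapted T c u ud b ((mem_wSubalgebra_iff b z T.short).mp hp).1

include T c hdual in
-- For the nontrivial inclusion, `ψ(v)` is subtracted to remove the part in `g_{-1}`. The difference
-- lies in `W`, so the retraction fixes it, yet replaces every element of `g_0` by its component in
-- `g_0^f`.
lemma wWeight_two (hs : s ∈ gr F x 1) : wWeight b κ x f s z 2 =
    ((gr F x (-1)).map (psi b e f (fun k => (u k : g)) (fun k => (ud k : g))) ⊔
      ((gr0Cent F x f).map (emb b)).map (del : Derivation F _ _).toLinearMap ⊔
      ((gr0Cent F x f).map (emb b)) ^ 2 : Submodule F (DiffPoly F ι)) := by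
  apply Set.Subset.antisymm
  · rintro p ⟨hp, hp2⟩
    obtain ⟨p', hp', Q, hQ, rfl⟩ := Submodule.mem_sup.mp (T.short.weightSpace_two_le b hp2)
    obtain ⟨_, ⟨v, hv, rfl⟩, _, ⟨_, ⟨q, hq, rfl⟩, rfl⟩, rfl⟩ := Submodule.mem_sup.mp hp'
    obtain ⟨Q', hQ', hψ⟩ := exists_psi_eq T u ud b hv
    have hψW := psi_mem_wSubalgebra T u ud hdual b z hs hv
    have hq' : q - (1 / 2 : F) • ⁅e, v⁆ ∈ gr F x 0 :=
      sub_mem hq (Submodule.smul_mem _ _ (T.lie_e_mem hv))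
    have hsub : emb b v + del (emb b q) + Q -
        psi b e f (fun k => (u k : g)) (fun k => (ud k : g)) v =
        del (emb b (q - (1 / 2 : F) • ⁅e, v⁆)) + (Q - Q') := by
      rw [hψ, map_sub (emb b), map_sub del]
      abel
    have hW : emb b v + del (emb b q) + Q -
        psi b e f (fun k => (u k : g)) (fun k => (ud k : g)) v ∈
        wSubalgebra b κ f s z T.short := sub_mem hp hψW
    have hret := retraction_of_mem T c u ud b z hdual hs hW
    rw [hsub, map_add, retraction_del, retraction_emb T c u ud b hq', ← hsub] at hret
    -- The retraction is an algebra homomorphism mapping `g_0` into `g_0^f`, hence quadratic terms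
    -- into `S² g_0^f`.
    have hQr : retraction T c u ud b (Q - Q') ∈ ((gr0Cent F x f).map (emb b)) ^ 2 := by
      have hle : ((gr F x 0).map (emb b)).map (retraction T c u ud b).toLinearMap ≤
          (gr0Cent F x f).map (emb b) := by
        rintro _ ⟨_, ⟨y, hy, rfl⟩, rfl⟩
        exact ⟨_, (T.centComp y).2, (retraction_emb T c u ud b hy).symm⟩
      refine pow_le_pow_left' hle 2 ?_
      rw [← Submodule.map_pow]
      exact ⟨_, sub_mem hQ hQ', rfl⟩
    change emb b v + del (emb b q) + Q ∈ _
    rw [eq_sub_iff_add_eq] at hret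
    rw [← hret, add_comm, ← add_assoc]
    exact Submodule.add_mem_sup (Submodule.add_mem_sup ⟨v, hv, rfl⟩
      ⟨_, ⟨_, (T.centComp _).2, rfl⟩, rfl⟩) hQr
  · have hle : (gr F x (-1)).map (psi b e f (fun k => (u k : g)) (fun k => (ud k : g))) ⊔
        ((gr0Cent F x f).map (emb b)).map (del : Derivation F _ _).toLinearMap ⊔
        ((gr0Cent F x f).map (emb b)) ^ 2 ≤
        Subalgebra.toSubmodule (wSubalgebra b κ f s z T.short) ⊓ weightSpace b x 2 := by
      refine sup_le (sup_le ?_ ?_) ?_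
      · rintro _ ⟨v, hv, rfl⟩
        exact ⟨psi_mem_wSubalgebra T u ud hdual b z hs hv, psi_mem_weightSpace T u ud b hv⟩
      · rintro _ ⟨_, ⟨q, hq, rfl⟩, rfl⟩
        exact ⟨del_iterate_mem_wSubalgebra b z T.short (emb_mem_wSubalgebra T b z hs hq) 1,
          del_emb_mem_weightSpace_two b hq.1⟩
      · rw [pow_two, Submodule.mul_le]
        rintro _ ⟨q, hq, rfl⟩ _ ⟨q', hq', rfl⟩
        exact ⟨Subalgebra.mul_mem _ (emb_mem_wSubalgebra T b z hs hq) (emb_mem_wSubalgebra T b z hs hq'),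
          emb_mul_emb_mem_weightSpace b hq.1 hq'.1⟩
    exact fun p hp => hle hp

end LowWeight

end ClassicalW

end

theorem theorem5p2
    {F : Type*} [Field F] [IsAlgClosed F] [CharZero F]
    {g : Type*} [LieRing g] [LieAlgebra F g] [FiniteDimensional F g] [LieAlgebra.IsSimple F g]
    (κ : LinearMap.BilinForm F g) (hsymm : κ.IsSymm) (hnd : κ.Nondegenerate)
    (hinv : ∀ p q r : g, κ ⁅p, q⁆ r = κ p ⁅q, r⁆)
    (e x f : g) (ht : IsSl2Triple ((2 : F) • x) e f) (hshort : ClassicalW.IsShort F x)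
    (s : g) (hs : s ∈ ClassicalW.gr F x 1) (z : F)
    {ι : Type*} (b : Module.Basis ι F g)
    {I : Type*} (a : Module.Basis I F (ClassicalW.gr0Cent F x f))
    {K : Type*} [Fintype K] [DecidableEq K]
    (u : Module.Basis K F (ClassicalW.gr F x (-1)))
    (ud : Module.Basis K F (ClassicalW.gr F x 1))
    (hdual : ∀ k l, κ (u k) (ud l) = if k = l then 1 else 0) :
    let W := ClassicalW.wAlgebra b κ x f s z
    let ψ := ClassicalW.psi b e f (fun k => (u k : g)) (fun k => (ud k : g))
    let G : Submodule F (ClassicalW.DiffPoly F ι) :=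
      (ClassicalW.gr0Cent F x f).map (ClassicalW.emb b)
    let Ψ := (ClassicalW.gr F x (-1)).map ψ
    let G' := G.map (ClassicalW.del : Derivation F _ _).toLinearMap
    ClassicalW.IsDiffPolyAlgebraOn W
        (Sum.elim (fun i => ClassicalW.emb b (a i : g)) (fun k => ψ (u k : g))) ∧
      Set.MapsTo ψ (ClassicalW.gr F x (-1)) (ClassicalW.wWeight b κ x f s z 2) ∧
      Set.InjOn ψ (ClassicalW.gr F x (-1)) ∧
      ClassicalW.wWeight b κ x f s z 1 = G ∧
      ClassicalW.wWeight b κ x f s z 2 = (Ψ ⊔ G' ⊔ G ^ 2 : Submodule F _) ∧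
      iSupIndep ![Ψ, G', G ^ 2] := by
  have T := ClassicalW.ShortTriple.of_isSl2Triple hsymm hinv ht hshort
  intro W ψ G Ψ G'
  refine ⟨⟨?_, ?_⟩, ?_, ?_, ?_, ?_, ?_⟩
  · exact congrArg SetLike.coe (ClassicalW.wSubalgebra_eq_adjoin T a u ud b z hdual hs)
  · exact ClassicalW.algebraicIndependent_wGen T a u ud b
  · intro v hv
    exact ⟨ClassicalW.psi_mem_wSubalgebra T u ud hdual b z hs hv,
      ClassicalW.psi_mem_weightSpace T u ud b hv⟩
  · exact ClassicalW.psi_injOn T u ud b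
  · exact ClassicalW.wWeight_one T u ud b z hdual hs
  · exact ClassicalW.wWeight_two T a u ud b z hdual hs
  · exact ClassicalW.iSupIndep_psi T u ud b
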